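/- **Conventions.** A Turing machine $(Q,\mathrm{START},\mathrm{HALT},\Sigma,\delta)$ consists of a finite set $Q$ with elements $\mathrm{START},\mathrm{HALT}$, a finite alphabet $\Sigma$ with at least two elements, and a map $\delta\colon (Q\setminus\{\mathrm{HALT}\})\times\Sigma\to Q\times\Sigma\times\{-1,0,1\}$. On an input tape $s\in\Sigma^{\mathbb Z}$ it starts in state $\mathrm{START}$ with tape $t=s$. It halts with output tape $t$ when the state is $\mathrm{HALT}$; otherwise, with $\delta(q,t_0)=(q',t_0',\epsilon)$, it replaces $q$ by $q'$, the symbol $t_0$ by $t_0'$, and then the tape $(t_n)_n$ by the shifted tape $(t_{n-\epsilon})_n$, and repeats. For an integer $k\ge 1$ put $b=10k$ and let $f\colon\{0,\dots,k\}^{\mathbb Z}\to(\mathbb R/\mathbb Z)^2$ be $$f(u)=\Big(\sum_{n\ge1}u_n b^{-n}\bmod 1,\ \sum_{n\ge1}u_{1-n}b^{-n}\bmod 1\Big),$$ whose image is a product of two Cantor sets. The circle $\mathbb R/\mathbb Z$ is identified with the unit circle in $\mathbb C$ through $\theta\mapsto e^{2\pi i\theta}$ and carries the distance of $\mathbb C$;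 products carry the maximum distance. **Proposition (Diffeomorphisms can be universal Turing machines).** Let $M=(\mathbb R/\mathbb Z)^2\times(\mathbb R/\mathbb Z)^2$ be the 4-torus. There exist a $C^\infty$ diffeomorphism $\Phi\colon M\to M$ that is computable (an algorithm computes the coordinates of $\Phi(z)$, for dyadic rational points $z$, to any prescribed accuracy), an integer $k\ge1$, points $x,h\in(\mathbb R/\mathbb Z)^2$ with rational coordinates, a rational number $\rho$, and an algorithm which, given the table of any Turing machine (with its states and symbols numbered in any way), produces * a block length $L\ge1$, * for each $a\in\Sigma$ two words $w_a,w_a^0\in\{0,\dots,k\}^L$, * a rule $r$ that assigns to each word in $\{0,\dots,k\}^L$ a natural number, computable from the table and the word, such that the following holds for every Turing machine. For $s\in\Sigma^{\mathbb Z}$ let $e(s)\in\{0,\dots,k\}^{\mathbb Z}$ be the tape whose block in the positions $Li,\dots,Li+L-1$ is $w_{s_i}$ for $i\ne0$ and $w^0_{s_0}$ for $i=0$, and let $$y_s=(x,f(e(s)))\in M.$$ For a finite string $t_{-n},\dots,t_n\in\Sigma$ let $C_{t_{-n},\dots,t_n}$ be the set of the tapes $u\in\{0,\dots,k\}^{\mathbb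 Z}$ such that $r(u_{Li},\dots,u_{Li+L-1})$ is the number of the symbol $t_i$ for all $-n\le i\le n$, and let $U_{t_{-n},\dots,t_n}=V\times W_{t_{-n},\dots,t_n}\subset M$, where $V$ is the open ball with centre $h$ and radius $\rho$, and $W_{t_{-n},\dots,t_n}$ is the open set of points at distance less than $b^{-(n+1)L}$ from some point of $f(C_{t_{-n},\dots,t_n})$. Then, for all $s\in\Sigma^{\mathbb Z}$, all $n\ge 0$ and all $t_{-n},\dots,t_n\in\Sigma$, the Turing machine with input tape $s$ halts with an output tape having coefficients $t_{-n},\dots,t_n$ in positions $-n,\dots,n$ respectively if and only if the orbit $y_s,\Phi(y_s),\Phi^2(y_s),\dots$ enters $U_{t_{-n},\dots,t_n}$, that is, $\Phi^m(y_s)\in U_{t_{-n},\dots,t_n}$ for some $m\ge0$. -/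

import Mathlib

open scoped Manifold ContDiff

/-! ### Turing machines with a two-sided infinite tape and a shifting tape -/

/-- A Turing machine with state set `Q` and alphabet `A`. The transition function is defined on
non-halting states only; its last output in `SignType = {-1, 0, 1}` is the shift of the tape. -/
structure TuringMachine (Q : Type*) (A : Type*) where
  start : Q
  halt : Q
  δ : {q : Q // q ≠ halt} → A → Q × A × SignType

namespace TuringMachine

variable {Q : Type*} {A : Type*}

open Classical in
/-- One step on a pair (state, tape): nothing happens in the halting state; otherwise the
symbol in position `0` is overwritten and the tape `t` is replaced by `n ↦ t (n - ε)`. -/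
noncomputable def next (T : TuringMachine Q A) (c : Q × (ℤ → A)) : Q × (ℤ → A) :=
  if h : c.1 = T.halt then c
  else
    ((T.δ ⟨c.1, h⟩ (c.2 0)).1,
      fun n => Function.update c.2 0 (T.δ ⟨c.1, h⟩ (c.2 0)).2.1
        (n - ((T.δ ⟨c.1, h⟩ (c.2 0)).2.2 : ℤ)))

/-- The machine, run on the input tape `s`, halts with output tape `t`. -/
def HaltsWithTape (T : TuringMachine Q A) (s t : ℤ → A) : Prop :=
  ∃ m : ℕ, T.next^[m] (T.start, s) = (T.halt, t)

/-- The machine, run on `s`, halts and its output tape has coefficients `t i` in the positions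
`-n ≤ i ≤ n`. -/
def HaltsWithOutput (T : TuringMachine Q A) (s : ℤ → A) (n : ℕ)
    (t : Set.Icc (-(n : ℤ)) (n : ℤ) → A) : Prop :=
  ∃ t' : ℤ → A, T.HaltsWithTape s t' ∧ ∀ i : Set.Icc (-(n : ℤ)) (n : ℤ), t' i = t i

/-- Finite descriptions of machines: number of states, number of symbols, initial state, halting
state, and the table of the transition function. -/
abbrev Code : Type := ℕ × ℕ × ℕ × ℕ × List (List (ℕ × ℕ × ℕ))

open Classical in
/-- The description of a machine with respect to numberings of its states and of its symbols.
The shift `ε` is written as `ε + 1`; the row of the halting state is filled with a dummy. -/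
noncomputable def code (T : TuringMachine Q A) {m l : ℕ} (eQ : Q ≃ Fin m) (eA : A ≃ Fin l) : Code :=
  (m, l, (eQ T.start : ℕ), (eQ T.halt : ℕ),
    List.ofFn fun q : Fin m => List.ofFn fun a : Fin l =>
      if h : eQ.symm q = T.halt then (0, 0, 0)
      else
        ((eQ (T.δ ⟨eQ.symm q, h⟩ (eA.symm a)).1 : ℕ),
          (eA (T.δ ⟨eQ.symm q, h⟩ (eA.symm a)).2.1 : ℕ),
          (((T.δ ⟨eQ.symm q, h⟩ (eA.symm a)).2.2 : ℤ) + 1).toNat))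

end TuringMachine

/-! ### The torus -/

abbrev Torus2 : Type := Circle × Circle

abbrev Torus4 : Type := Torus2 × Torus2

/-- The model with corners of the smooth manifold `Torus4` (a product of four circles). -/
noncomputable abbrev torus4Model :=
  (((𝓡 1).prod (𝓡 1)).prod ((𝓡 1).prod (𝓡 1)))

/-- The point of the torus `(ℝ/ℤ)²` with coordinates `x mod 1`, where `ℝ/ℤ` is identified with the
unit circle through `θ ↦ exp (2πiθ)`. -/
noncomputable def toTorus2 (x : ℝ × ℝ) : Torus2 :=
  (Circle.exp (2 * Real.pi * x.1), Circle.exp (2 * Real.pi * x.2))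

noncomputable def toTorus4 (x : (ℝ × ℝ) × (ℝ × ℝ)) : Torus4 :=
  (toTorus2 x.1, toTorus2 x.2)

/-- The point with dyadic coordinates `aᵢ / 2 ^ p`. -/
noncomputable def dyadic (p : ℕ) (a : (ℕ × ℕ) × (ℕ × ℕ)) : (ℝ × ℝ) × (ℝ × ℝ) :=
  (((a.1.1 : ℝ) / 2 ^ p, (a.1.2 : ℝ) / 2 ^ p), ((a.2.1 : ℝ) / 2 ^ p, (a.2.2 : ℝ) / 2 ^ p))

/-- There is an algorithm that computes, for each dyadic point, the coordinates of its image
under `F` up to an error `2 ^ (-r)`, with `r` part of the input. For Lipschitz `F`, in particular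
for smooth `F`, this is computability of `F` in the sense of computable analysis, because the
Lipschitz constant provides the modulus of continuity. -/
def IsComputableTorusMap (F : Torus4 → Torus4) : Prop :=
  ∃ g : ℕ × ℕ × ((ℕ × ℕ) × (ℕ × ℕ)) → (ℕ × ℕ) × (ℕ × ℕ), Computable g ∧
    ∀ (p r : ℕ) (a : (ℕ × ℕ) × (ℕ × ℕ)), ∃ θ : (ℝ × ℝ) × (ℝ × ℝ),
      F (toTorus4 (dyadic p a)) = toTorus4 θ ∧ dist θ (dyadic r (g (p, r, a))) ≤ (1 / 2) ^ r

/-! ### Tapes as points of a Cantor set -/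

/-- The embedding of the tapes over `{0, …, k}` into the 2-torus, with base `b = 10 k`: the
tape `t` goes to `(∑_{n ≥ 1} t_n b^{-n} mod 1, ∑_{n ≥ 1} t_{1-n} b^{-n} mod 1)`. -/
noncomputable def cantorPoint (k : ℕ) (t : ℤ → Fin (k + 1)) : Torus2 :=
  toTorus2
    (∑' n : ℕ, ((t ((n : ℤ) + 1) : ℕ) : ℝ) / (10 * (k : ℝ)) ^ (n + 1),
      ∑' n : ℕ, ((t (-(n : ℤ)) : ℕ) : ℝ) / (10 * (k : ℝ)) ^ (n + 1))

/-- The `i`-th block of length `L` of a tape. -/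
def tapeBlock {B : Type*} (L : ℕ) (t : ℤ → B) (i : ℤ) : List B :=
  List.ofFn fun r : Fin L => t ((L : ℤ) * i + ((r : ℕ) : ℤ))

/-- An algorithm that turns a description of a Turing machine into a block code over the
alphabet `{0, …, k}`: a block length, the words that stand for the symbols (one word for a symbol
in position `0` of the tape, one for the same symbol in any other position), and a map that reads
a symbol off a word. -/
structure BlockCoding (k : ℕ) where
  /-- block length -/
  len : TuringMachine.Code → ℕ
  /-- `digit (c, o, a, r)` is the letter number `r` in the word for the symbol number `a`; `o` says
  whether the symbol stands in position `0` of the tape -/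
  digit : TuringMachine.Code × Bool × ℕ × ℕ → Fin (k + 1)
  /-- the number of the symbol that is read off a word -/
  read : TuringMachine.Code × List (Fin (k + 1)) → ℕ
  len_pos : ∀ c, 0 < len c
  computable_len : Computable len
  computable_digit : Computable digit
  computable_read : Computable read

namespace BlockCoding

variable {k : ℕ} {A : Type*} {l : ℕ}

/-- The tape over `{0, …, k}` obtained from `s` by writing, for each symbol of `s`, its word. -/
def encode (K : BlockCoding k) (c : TuringMachine.Code) (eA : A ≃ Fin l) (s : ℤ → A) :
    ℤ → Fin (k + 1) :=
  fun j => K.digit (c, decide (j / (K.len c : ℤ) = 0), (eA (s (j / (K.len c : ℤ))) : ℕ),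
    (j % (K.len c : ℤ)).toNat)

/-- The set of tapes over `{0, …, k}` from whose blocks number `-n, …, n` the string `t` is read. -/
def cylinder (K : BlockCoding k) (c : TuringMachine.Code) (eA : A ≃ Fin l) (n : ℕ)
    (t : Set.Icc (-(n : ℤ)) (n : ℤ) → A) : Set (ℤ → Fin (k + 1)) :=
  {u | ∀ i : Set.Icc (-(n : ℤ)) (n : ℤ), K.read (c, tapeBlock (K.len c) u i) = (eA (t i) : ℕ)}

/-- The point `y_s`: a fixed rational point in the first 2-torus, and in the second one the point
of the Cantor set that encodes `s`. -/
noncomputable def inputPoint (K : BlockCoding k) (c : TuringMachine.Code) (eA : A ≃ Fin l)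
    (x : ℚ × ℚ) (s : ℤ → A) : Torus4 :=
  (toTorus2 ((x.1 : ℝ), (x.2 : ℝ)), cantorPoint k (K.encode c eA s))

/-- The open set `U_t = V × W_t`: here `V` is the ball with rational centre `h` and rational
radius `ρ`, and `W_t` is the neighbourhood with radius `b ^ (-(n + 1) L)`, where `b = 10 k` and
`L` is the block length, of the part of the Cantor set that encodes tapes from which `t` is read. -/
noncomputable def outputSet (K : BlockCoding k) (c : TuringMachine.Code) (eA : A ≃ Fin l)
    (h : ℚ × ℚ) (ρ : ℚ) (n : ℕ) (t : Set.Icc (-(n : ℤ)) (n : ℤ) → A) :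
    TopologicalSpace.Opens Torus4 :=
  ⟨Metric.ball (toTorus2 ((h.1 : ℝ), (h.2 : ℝ))) (ρ : ℝ) ×ˢ
      Metric.thickening (((10 * (k : ℝ)) ^ ((n + 1) * K.len c))⁻¹)
        (cantorPoint k '' K.cylinder c eA n t),
    Metric.isOpen_ball.prod Metric.isOpen_thickening⟩

end BlockCoding

/-!
The tape of `T` is encoded in such a way that every block carries the table of `T` next to its
symbol. A fixed universal machine, which at each step rewrites the beginnings of the two halves of
its tape according to their first few letters, can then simulate `T`.

On the Cantor set of tapes such a step acts on each coordinate as one of finitely many affine maps,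
selected by a window of digits. It need not be injective, so the window is first added to the first
coordinate of the torus, the history, which is contracted at every step and thus stays small. The
step then becomes a composition of shears in which each coordinate is changed by a smooth computable
function of the others, the second coordinate serving as workspace that is returned to `1`. Hence it
extends to a computable diffeomorphism of the whole torus. The halting condition can be read off an
open set because close points of the Cantor set share their first digits.
-/

/-! ### Computable families of real numbers -/

theorem primrec_nat_pow : Primrec₂ ((· ^ ·) : ℕ → ℕ → ℕ) :=
  Primrec₂.unpaired'.1 Nat.Primrec.pow

/-- A family of rational numbers, regarded as real numbers, that is computed by an algorithm.
The numerator is encoded as the difference of two natural numbers. -/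
def IsComputableRat {ι : Type*} [Primcodable ι] (w : ι → ℝ) : Prop :=
  ∃ a b d : ι → ℕ, Computable a ∧ Computable b ∧ Computable d ∧
    ∀ i, 0 < d i ∧ w i = ((a i : ℝ) - b i) / d i

namespace IsComputableRat

variable {ι κ : Type*} [Primcodable ι] [Primcodable κ] {v w : ι → ℝ}

theorem comp (hv : IsComputableRat v) {f : κ → ι} (hf : Computable f) :
    IsComputableRat fun j => v (f j) := by
  obtain ⟨a, b, d, ha, hb, hd, h⟩ := hv
  exact ⟨_, _, _, ha.comp hf, hb.comp hf, hd.comp hf, fun j => h (f j)⟩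

theorem natCast {f : ι → ℕ} (hf : Computable f) : IsComputableRat fun i => (f i : ℝ) :=
  ⟨f, fun _ => 0, fun _ => 1, hf, Computable.const 0, Computable.const 1, fun i => by simp⟩

theorem const (q : ℚ) : IsComputableRat fun _ : ι => (q : ℝ) := by
  refine ⟨fun _ => q.num.toNat, fun _ => (-q.num).toNat, fun _ => q.den, Computable.const _,
    Computable.const _, Computable.const _, fun _ => ⟨q.den_pos, ?_⟩⟩
  have hnum : (q.num.toNat : ℝ) - ((-q.num).toNat : ℝ) = (q.num : ℝ) := by
    exact_mod_cast Int.toNat_sub_toNat_neg q.num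
  rw [hnum, ← Rat.cast_def]

theorem neg (hv : IsComputableRat v) : IsComputableRat fun i => -v i := by
  obtain ⟨a, b, d, ha, hb, hd, h⟩ := hv
  refine ⟨b, a, d, hb, ha, hd, fun i => ⟨(h i).1, ?_⟩⟩
  beta_reduce
  rw [(h i).2, ← neg_div, neg_sub]

theorem add (hv : IsComputableRat v) (hw : IsComputableRat w) :
    IsComputableRat fun i => v i + w i := by
  obtain ⟨a, b, d, ha, hb, hd, h⟩ := hv
  obtain ⟨a', b', d', ha', hb', hd', h'⟩ := hw
  have hadd := Primrec.nat_add.to_comp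
  have hmul := Primrec.nat_mul.to_comp
  refine ⟨fun i => a i * d' i + a' i * d i, fun i => b i * d' i + b' i * d i,
    fun i => d i * d' i, hadd.comp (hmul.comp ha hd') (hmul.comp ha' hd),
    hadd.comp (hmul.comp hb hd') (hmul.comp hb' hd), hmul.comp hd hd',
    fun i => ⟨Nat.mul_pos (h i).1 (h' i).1, ?_⟩⟩
  have hdi : (d i : ℝ) ≠ 0 := Nat.cast_ne_zero.2 (h i).1.ne'
  have hdi' : (d' i : ℝ) ≠ 0 := Nat.cast_ne_zero.2 (h' i).1.ne'
  beta_reduce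
  rw [(h i).2, (h' i).2]
  push_cast
  field_simp
  ring

theorem sub (hv : IsComputableRat v) (hw : IsComputableRat w) :
    IsComputableRat fun i => v i - w i := by
  simpa only [sub_eq_add_neg] using hv.add hw.neg

theorem mul (hv : IsComputableRat v) (hw : IsComputableRat w) :
    IsComputableRat fun i => v i * w i := by
  obtain ⟨a, b, d, ha, hb, hd, h⟩ := hv
  obtain ⟨a', b', d', ha', hb', hd', h'⟩ := hw
  have hadd := Primrec.nat_add.to_comp
  have hmul := Primrec.nat_mul.to_comp
  refine ⟨fun i => a i * a' i + b i * b' i, fun i => a i * b' i + b i * a' i,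
    fun i => d i * d' i, hadd.comp (hmul.comp ha ha') (hmul.comp hb hb'),
    hadd.comp (hmul.comp ha hb') (hmul.comp hb ha'), hmul.comp hd hd',
    fun i => ⟨Nat.mul_pos (h i).1 (h' i).1, ?_⟩⟩
  beta_reduce
  rw [(h i).2, (h' i).2, div_mul_div_comm]
  push_cast
  ring

theorem inv (hv : IsComputableRat v) (hpos : ∀ i, 0 < v i) :
    IsComputableRat fun i => (v i)⁻¹ := by
  obtain ⟨a, b, d, ha, hb, hd, h⟩ := hv
  have hba : ∀ i, b i < a i := fun i => by
    have hdi : (0 : ℝ) < d i := Nat.cast_pos.2 (h i).1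
    have hi := hpos i
    rw [(h i).2, div_pos_iff_of_pos_right hdi, sub_pos] at hi
    exact_mod_cast hi
  refine ⟨d, fun _ => 0, fun i => a i - b i, hd, Computable.const 0,
    Primrec.nat_sub.to_comp.comp ha hb, fun i => ⟨Nat.sub_pos_of_lt (hba i), ?_⟩⟩
  beta_reduce
  rw [(h i).2, inv_div, Nat.cast_sub (hba i).le, Nat.cast_zero, sub_zero]

theorem div (hv : IsComputableRat v) (hw : IsComputableRat w) (hpos : ∀ i, 0 < w i) :
    IsComputableRat fun i => v i / w i := by
  simpa only [div_eq_mul_inv] using hv.mul (hw.inv hpos)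

theorem max_zero (hv : IsComputableRat v) : IsComputableRat fun i => max (v i) 0 := by
  obtain ⟨a, b, d, ha, hb, hd, h⟩ := hv
  refine ⟨fun i => a i - b i, fun _ => 0, d, Primrec.nat_sub.to_comp.comp ha hb,
    Computable.const 0, hd, fun i => ⟨(h i).1, ?_⟩⟩
  have hcast : ((a i - b i : ℕ) : ℝ) = max ((a i : ℝ) - b i) 0 := by
    rcases le_total (b i) (a i) with hle | hle
    · rw [Nat.cast_sub hle, max_eq_left (sub_nonneg.2 (Nat.cast_le.2 hle))]
    · rw [Nat.sub_eq_zero_of_le hle, Nat.cast_zero,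
        max_eq_right (sub_nonpos.2 (Nat.cast_le.2 hle))]
  beta_reduce
  rw [(h i).2, Nat.cast_zero, sub_zero, hcast, ← max_div_div_right (Nat.cast_nonneg _), zero_div]

theorem max (hv : IsComputableRat v) (hw : IsComputableRat w) :
    IsComputableRat fun i => max (v i) (w i) := by
  convert (hv.sub hw).max_zero.add hw using 2 with i
  rw [max_add, sub_add_cancel, zero_add]

theorem pow (hv : IsComputableRat v) (hv0 : ∀ i, 0 ≤ v i) {f : ι → ℕ} (hf : Computable f) :
    IsComputableRat fun i => v i ^ f i := by
  obtain ⟨a, b, d, ha, hb, hd, h⟩ := hv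
  refine ⟨fun i => (a i - b i) ^ f i, fun _ => 0, fun i => d i ^ f i,
    primrec_nat_pow.to_comp.comp (Primrec.nat_sub.to_comp.comp ha hb) hf, Computable.const 0,
    primrec_nat_pow.to_comp.comp hd hf, fun i => ⟨Nat.pow_pos (h i).1, ?_⟩⟩
  have hba : b i ≤ a i := by
    have hdi : (0 : ℝ) < d i := Nat.cast_pos.2 (h i).1
    have hi := hv0 i
    rw [(h i).2, le_div_iff₀ hdi, zero_mul, sub_nonneg] at hi
    exact_mod_cast hi
  beta_reduce
  rw [(h i).2, div_pow, Nat.cast_zero, sub_zero, Nat.cast_pow, Nat.cast_pow, Nat.cast_sub hba]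

theorem computable_floor (hv : IsComputableRat v) : Computable fun i => ⌊v i⌋₊ := by
  obtain ⟨a, b, d, ha, hb, hd, h⟩ := hv
  refine (Primrec.nat_div.to_comp.comp (Primrec.nat_sub.to_comp.comp ha hb) hd).of_eq fun i => ?_
  rw [(h i).2]
  rcases le_total (b i) (a i) with hle | hle
  · rw [← Nat.cast_sub hle, Nat.floor_div_eq_div]
  · have hle' : (a i : ℝ) - b i ≤ 0 := sub_nonpos.2 (Nat.cast_le.2 hle)
    rw [Nat.sub_eq_zero_of_le hle, Nat.zero_div,
      Nat.floor_of_nonpos (div_nonpos_of_nonpos_of_nonneg hle' (Nat.cast_nonneg _))]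

theorem fract (hv : IsComputableRat v) (hv0 : ∀ i, 0 ≤ v i) :
    IsComputableRat fun i => Int.fract (v i) := by
  convert hv.sub (natCast hv.computable_floor) using 2 with i
  rw [Int.fract, natCast_floor_eq_intCast_floor (hv0 i)]

end IsComputableRat

/-- A family of real numbers is computable if an algorithm computes rational approximations of its
members to any prescribed accuracy. -/
def IsComputableReal {ι : Type*} [Primcodable ι] (v : ι → ℝ) : Prop :=
  ∃ w : ι × ℕ → ℝ, IsComputableRat w ∧ ∀ i r, |v i - w (i, r)| ≤ (1 / 2) ^ r

theorem IsComputableRat.isComputableReal {ι : Type*} [Primcodable ι] {v : ι → ℝ}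
    (hv : IsComputableRat v) : IsComputableReal v :=
  ⟨fun x => v x.1, hv.comp Computable.fst, fun i r => by rw [sub_self, abs_zero]; positivity⟩

namespace IsComputableReal

variable {ι κ : Type*} [Primcodable ι] [Primcodable κ] {v w : ι → ℝ}

theorem comp (hv : IsComputableReal v) {f : κ → ι} (hf : Computable f) :
    IsComputableReal fun j => v (f j) := by
  obtain ⟨x, hx, h⟩ := hv
  exact ⟨fun y => x (f y.1, y.2), hx.comp ((hf.comp Computable.fst).pair Computable.snd),
    fun j r => h (f j) r⟩

theorem const (q : ℚ) : IsComputableReal fun _ : ι => (q : ℝ) :=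
  (IsComputableRat.const q).isComputableReal

theorem of_abs_sub_le {x : ι × ℕ → ℝ} (hx : IsComputableRat x) (C : ℝ)
    (h : ∀ i r, |v i - x (i, r)| ≤ C * (1 / 2) ^ r) : IsComputableReal v := by
  obtain ⟨s, hs⟩ := pow_unbounded_of_one_lt C one_lt_two
  have hshift : Computable fun y : ι × ℕ => (y.1, y.2 + s) :=
    Computable.fst.pair (Primrec.nat_add.to_comp.comp Computable.snd (Computable.const s))
  refine ⟨fun y => x (y.1, y.2 + s), hx.comp hshift, fun i r => ?_⟩
  calc |v i - x (i, r + s)| ≤ C * (1 / 2) ^ (r + s) := h i (r + s)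
    _ ≤ 2 ^ s * (1 / 2) ^ (r + s) := by gcongr
    _ = (1 / 2) ^ r := by rw [pow_add, mul_left_comm, ← mul_pow]; norm_num

theorem neg (hv : IsComputableReal v) : IsComputableReal fun i => -v i := by
  obtain ⟨x, hx, h⟩ := hv
  refine ⟨_, hx.neg, fun i r => ?_⟩
  rw [← neg_sub', abs_neg]
  exact h i r

theorem add (hv : IsComputableReal v) (hw : IsComputableReal w) :
    IsComputableReal fun i => v i + w i := by
  obtain ⟨x, hx, h⟩ := hv
  obtain ⟨y, hy, h'⟩ := hw
  refine of_abs_sub_le (hx.add hy) 2 fun i r => ?_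
  calc |v i + w i - (x (i, r) + y (i, r))| = |(v i - x (i, r)) + (w i - y (i, r))| := by ring_nf
    _ ≤ (1 / 2) ^ r + (1 / 2) ^ r := (abs_add_le _ _).trans (add_le_add (h i r) (h' i r))
    _ = 2 * (1 / 2) ^ r := (two_mul _).symm

theorem mul (hv : IsComputableReal v) (hw : IsComputableReal w) {B C : ℝ}
    (hvB : ∀ i, |v i| ≤ B) (hwC : ∀ i, |w i| ≤ C) : IsComputableReal fun i => v i * w i := by
  obtain ⟨x, hx, h⟩ := hv
  obtain ⟨y, hy, h'⟩ := hw
  refine of_abs_sub_le (hx.mul hy) (B + (C + 1)) fun i r => ?_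
  have hB : 0 ≤ B := (abs_nonneg _).trans (hvB i)
  have hy : |y (i, r)| ≤ C + 1 := by
    have hy1 : |w i - y (i, r)| ≤ 1 := (h' i r).trans (pow_le_one₀ (by norm_num) (by norm_num))
    have := abs_sub_abs_le_abs_sub (y (i, r)) (w i)
    rw [abs_sub_comm] at this
    linarith [hwC i]
  calc |v i * w i - x (i, r) * y (i, r)|
      = |v i * (w i - y (i, r)) + (v i - x (i, r)) * y (i, r)| := by ring_nf
    _ ≤ |v i| * |w i - y (i, r)| + |v i - x (i, r)| * |y (i, r)| := by
      rw [← abs_mul, ← abs_mul]; exact abs_add_le _ _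
    _ ≤ B * (1 / 2) ^ r + (1 / 2) ^ r * (C + 1) := by
      gcongr
      exacts [hvB i, h' i r, h i r]
    _ = (B + (C + 1)) * (1 / 2) ^ r := by ring

theorem inv (hv : IsComputableReal v) {m : ℝ} (hm : 0 < m) (hvm : ∀ i, m ≤ v i) :
    IsComputableReal fun i => (v i)⁻¹ := by
  obtain ⟨x, hx, h⟩ := hv
  obtain ⟨q, hq0, hqm⟩ := exists_rat_btwn hm
  have hy : ∀ i r, (q : ℝ) ≤ max (x (i, r)) q := fun i r => le_max_right _ _
  refine of_abs_sub_le ((hx.max (IsComputableRat.const q)).inv fun i => hq0.trans_le (hy i.1 i.2))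
    (q * q)⁻¹ fun i r => ?_
  have hv : (q : ℝ) ≤ v i := hqm.le.trans (hvm i)
  have hv0 : 0 < v i := hq0.trans_le hv
  have hy0 : 0 < max (x (i, r)) q := hq0.trans_le (hy i r)
  have hle : |v i - max (x (i, r)) q| ≤ (1 / 2) ^ r := by
    have hsup := abs_sup_sub_sup_le_abs (v i) (x (i, r)) (q : ℝ)
    rw [max_eq_left hv] at hsup
    exact hsup.trans (h i r)
  calc |(v i)⁻¹ - (max (x (i, r)) q)⁻¹|
      = (v i * max (x (i, r)) q)⁻¹ * |v i - max (x (i, r)) q| := by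
        rw [inv_sub_inv hv0.ne' hy0.ne', abs_div, abs_of_pos (mul_pos hv0 hy0), abs_sub_comm,
          div_eq_inv_mul]
    _ ≤ (q * q : ℝ)⁻¹ * (1 / 2) ^ r := by
      gcongr
      exact hy i r

theorem exists_nat_approx (hv : IsComputableReal v) (hv0 : ∀ i, 0 ≤ v i) :
    ∃ g : ι × ℕ → ℕ, Computable g ∧ ∀ i r, |v i - (g (i, r) : ℝ) / 2 ^ r| ≤ (1 / 2) ^ r := by
  obtain ⟨x, hx, h⟩ := hv
  have hy : IsComputableRat fun y : ι × ℕ => ((2 ^ y.2 : ℕ) : ℝ) * x (y.1, y.2 + 1) + (1 / 2 : ℚ) :=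
    ((IsComputableRat.natCast (primrec_nat_pow.to_comp.comp (Computable.const 2)
      Computable.snd)).mul (hx.comp (Computable.fst.pair
        (Computable.succ.comp Computable.snd)))).add (IsComputableRat.const _)
  refine ⟨_, hy.computable_floor, fun i r => ?_⟩
  have hp : (0 : ℝ) < 2 ^ r := by positivity
  have hr : (2 : ℝ) ^ r * (1 / 2) ^ r = 1 := by rw [← mul_pow]; norm_num
  have hv2 : |2 ^ r * v i - 2 ^ r * x (i, r + 1)| ≤ 1 / 2 := by
    rw [← mul_sub, abs_mul, abs_of_pos hp]
    calc (2 : ℝ) ^ r * |v i - x (i, r + 1)| ≤ 2 ^ r * (1 / 2) ^ (r + 1) := by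
          gcongr
          exact h i (r + 1)
      _ = 1 / 2 := by rw [pow_succ, ← mul_assoc, hr, one_mul]
  obtain ⟨hlo, hhi⟩ := abs_le.1 hv2
  push_cast
  set y : ℝ := 2 ^ r * x (i, r + 1) + 1 / 2 with hy_def
  have hy0 : 0 ≤ y := by linarith [mul_nonneg hp.le (hv0 i)]
  have hfloor : |2 ^ r * v i - ⌊y⌋₊| ≤ 1 :=
    abs_le.2 ⟨by linarith [Nat.floor_le hy0], by linarith [Nat.lt_floor_add_one y]⟩
  calc |v i - ⌊y⌋₊ / 2 ^ r| = |2 ^ r * v i - ⌊y⌋₊| / 2 ^ r := by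
        rw [← abs_of_pos hp, ← abs_div, abs_of_pos hp]; congr 1; field_simp
    _ ≤ 1 / 2 ^ r := by gcongr
    _ = (1 / 2) ^ r := by rw [one_div, one_div, inv_pow]

end IsComputableReal

/-! ### Smooth bump functions on the circle -/

theorem abs_exp_neg_sub_inv_pow_le {y : ℝ} (hy : 0 < y) {N : ℕ} (hN : 0 < N) :
    |Real.exp (-y) - (1 + y / N)⁻¹ ^ N| ≤ min (y ^ 2 / N) y⁻¹ := by
  have hN' : (0 : ℝ) < N := Nat.cast_pos.2 hN
  set z := y / N with hz_def
  have hz : 0 < z := div_pos hy hN'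
  have hNz : N * z = y := mul_div_cancel₀ y hN'.ne'
  have hexp : Real.exp (-y) = Real.exp (-z) ^ N := by
    rw [← Real.exp_nat_mul, mul_neg, hNz]
  have hlower : 1 - z ≤ Real.exp (-z) := by linarith [Real.add_one_le_exp (-z)]
  have hupper : Real.exp (-z) ≤ (1 + z)⁻¹ := by
    rw [Real.exp_neg]
    exact inv_anti₀ (by positivity) (by linarith [Real.add_one_le_exp z])
  have hinv : (1 + z)⁻¹ ≤ 1 - z + z ^ 2 := by
    rw [inv_le_iff_one_le_mul₀ (by positivity)]
    linarith [pow_pos hz 3]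
  have hinv_one : (1 + z)⁻¹ ≤ 1 := inv_le_one_of_one_le₀ (by linarith)
  have hpow : Real.exp (-z) ^ N ≤ (1 + z)⁻¹ ^ N := by gcongr
  rw [hexp, abs_sub_comm, abs_of_nonneg (sub_nonneg.2 hpow), le_min_iff]
  constructor
  · have hsub := (le_abs_self _).trans (abs_pow_sub_pow_le (1 + z)⁻¹ (Real.exp (-z)) N)
    rw [abs_of_nonneg (sub_nonneg.2 hupper), abs_of_nonneg (by positivity : 0 ≤ (1 + z)⁻¹),
      abs_of_pos (Real.exp_pos _), max_eq_left hupper] at hsub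
    calc (1 + z)⁻¹ ^ N - Real.exp (-z) ^ N
        ≤ ((1 + z)⁻¹ - Real.exp (-z)) * N * (1 + z)⁻¹ ^ (N - 1) := hsub
      _ ≤ z ^ 2 * N * 1 := by
        gcongr
        · linarith
        · exact pow_le_one₀ (by positivity) hinv_one
      _ = y ^ 2 / N := by rw [hz_def]; field_simp
  · have hbernoulli : y ≤ (1 + z) ^ N := by
      linarith [one_add_mul_le_pow (by linarith : -2 ≤ z) N]
    calc (1 + z)⁻¹ ^ N - Real.exp (-z) ^ N ≤ ((1 + z) ^ N)⁻¹ := by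
          rw [inv_pow]; linarith [pow_pos (Real.exp_pos (-z)) N]
      _ ≤ y⁻¹ := inv_anti₀ hy hbernoulli

/-- For `x ≥ 2⁻ʳ` the error is bounded by `x⁻² / 8ʳ`, for smaller `x` by `x` itself. -/
theorem abs_expNegInvGlue_sub_le {x : ℝ} (hx : 0 ≤ x) (r : ℕ) :
    |expNegInvGlue x - (x / (x + ((8 ^ r : ℕ) : ℝ)⁻¹)) ^ 8 ^ r| ≤ (1 / 2) ^ r := by
  rcases hx.eq_or_lt with rfl | hx
  · simp
  have hbase : x / (x + ((8 ^ r : ℕ) : ℝ)⁻¹) = (1 + x⁻¹ / (8 ^ r : ℕ))⁻¹ := by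
    field_simp
  rw [expNegInvGlue, if_neg hx.not_ge, hbase]
  refine (abs_exp_neg_sub_inv_pow_le (inv_pos.2 hx) (by positivity)).trans ?_
  rcases le_total x ((1 / 2) ^ r) with hsmall | hlarge
  · exact (min_le_right _ _).trans ((inv_inv x).le.trans hsmall)
  · have hinv : x⁻¹ ≤ 2 ^ r := by
      rw [inv_le_comm₀ hx (by positivity), ← inv_pow, ← one_div]
      exact hlarge
    calc min (x⁻¹ ^ 2 / (8 ^ r : ℕ)) x⁻¹⁻¹ ≤ x⁻¹ ^ 2 / (8 ^ r : ℕ) := min_le_left _ _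
      _ ≤ (2 ^ r) ^ 2 / (8 ^ r : ℕ) := by gcongr
      _ = (1 / 2) ^ r := by
        push_cast
        rw [← pow_mul, mul_comm r, pow_mul, ← div_pow]
        norm_num

theorem expNegInvGlue_max_zero (x : ℝ) : expNegInvGlue (max x 0) = expNegInvGlue x := by
  rcases le_total x 0 with h | h
  · rw [max_eq_right h, expNegInvGlue.zero, expNegInvGlue.zero_of_nonpos h]
  · rw [max_eq_left h]

theorem expNegInvGlue_le_one (x : ℝ) : expNegInvGlue x ≤ 1 := by
  rw [expNegInvGlue]
  split_ifs with h
  · exact zero_le_one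
  · exact Real.exp_le_one_iff.2 (neg_nonpos.2 (inv_nonneg.2 (not_le.1 h).le))

theorem expNegInvGlue_half_le (x : ℝ) :
    expNegInvGlue (1 / 2) ≤ expNegInvGlue x + expNegInvGlue (1 - x) := by
  rcases le_total (1 / 2) x with h | h
  · linarith [expNegInvGlue.monotone h, expNegInvGlue.nonneg (1 - x)]
  · linarith [expNegInvGlue.monotone (by linarith : 1 / 2 ≤ 1 - x), expNegInvGlue.nonneg x]

namespace IsComputableRat

variable {ι : Type*} [Primcodable ι] {v : ι → ℝ}

theorem expNegInvGlue (hv : IsComputableRat v) :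
    IsComputableReal fun i => expNegInvGlue (v i) := by
  have h8 : Computable fun x : ι × ℕ => 8 ^ x.2 :=
    primrec_nat_pow.to_comp.comp (Computable.const 8) Computable.snd
  have h8pos : ∀ x : ι × ℕ, (0 : ℝ) < (8 ^ x.2 : ℕ) := fun x => by positivity
  have hmax := hv.max_zero.comp (Computable.fst (β := ℕ))
  have hden := hmax.add ((natCast h8).inv h8pos)
  refine ⟨_, (hmax.div hden fun x => ?_).pow (fun x => ?_) h8, fun i r => ?_⟩
  · exact add_pos_of_nonneg_of_pos (le_max_right _ _) (inv_pos.2 (h8pos x))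
  · exact div_nonneg (le_max_right _ _)
      (add_nonneg (le_max_right _ _) (inv_nonneg.2 (h8pos x).le))
  · beta_reduce
    rw [← expNegInvGlue_max_zero]
    exact abs_expNegInvGlue_sub_le (le_max_right _ _) r

theorem smoothTransition (hv : IsComputableRat v) :
    IsComputableReal fun i => Real.smoothTransition (v i) := by
  have hone : IsComputableRat fun i => 1 - v i := by
    simpa only [Rat.cast_one] using (const 1).sub hv
  have hm : 0 < _root_.expNegInvGlue (1 / 2) := expNegInvGlue.pos_of_pos (by norm_num)
  have hinv := (hv.expNegInvGlue.add hone.expNegInvGlue).inv hm fun i => expNegInvGlue_half_le (v i)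
  refine hv.expNegInvGlue.mul hinv (B := 1) (C := (_root_.expNegInvGlue (1 / 2))⁻¹)
    (fun i => ?_) fun i => ?_
  · rw [abs_of_nonneg (expNegInvGlue.nonneg _)]
    exact expNegInvGlue_le_one _
  · have hle := expNegInvGlue_half_le (v i)
    rw [abs_of_pos (inv_pos.2 (hm.trans_le hle))]
    exact inv_anti₀ hm hle

end IsComputableRat

/-- The point of the circle with coordinate `θ mod 1`. -/
noncomputable def circlePt (θ : ℝ) : Circle := Circle.exp (2 * Real.pi * θ)

theorem circlePt_add (a b : ℝ) : circlePt (a + b) = circlePt a * circlePt b := by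
  simp only [circlePt, mul_add, Circle.exp_add]

theorem circlePt_zero : circlePt 0 = 1 := by rw [circlePt, mul_zero, Circle.exp_zero]

theorem circlePt_add_int (a : ℝ) (n : ℤ) : circlePt (a + n) = circlePt a := by
  rw [circlePt_add, circlePt, circlePt, Circle.exp_two_pi_mul_int, mul_one]

theorem contMDiff_circlePt : ContMDiff 𝓘(ℝ, ℝ) (𝓡 1) ∞ circlePt :=
  contMDiff_circleExp.comp (contDiff_const.mul contDiff_id).contMDiff

/-- The function on the circle that is `H (θ + 1/2)` at the point with coordinate
`θ ∈ (-1/2, 1/2]`. -/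
noncomputable def circleFun (H : ℝ → ℝ) (w : Circle) : ℝ :=
  H (Complex.arg w / (2 * Real.pi) + 1 / 2)

theorem circleFun_circlePt {H : ℝ → ℝ} (h01 : H 0 = H 1) (x : ℝ) :
    circleFun H (circlePt x) = H (Int.fract (x + 1 / 2)) := by
  have hpi := Real.pi_pos
  have hcoord : ∀ θ ∈ Set.Ioc (-1 / 2 : ℝ) (1 / 2), circleFun H (circlePt θ) = H (θ + 1 / 2) := by
    rintro θ ⟨hlo, hhi⟩
    rw [circleFun, circlePt, Circle.arg_exp (by nlinarith) (by nlinarith),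
      mul_div_cancel_left₀ _ (by positivity)]
  have hx : x = Int.fract (x + 1 / 2) - 1 / 2 + ⌊x + 1 / 2⌋ := by
    rw [Int.fract]; ring
  rcases (Int.fract_nonneg (x + 1 / 2)).eq_or_lt with hzero | hpos
  · have hx' : x = 1 / 2 + (⌊x + 1 / 2⌋ - 1 : ℤ) := by
      rw [← hzero] at hx; push_cast; linarith
    rw [← hzero, h01, hx', circlePt_add_int, hcoord _ (by norm_num), add_halves]
  · conv_lhs => rw [hx]
    have hlt := Int.fract_lt_one (x + 1 / 2)
    rw [circlePt_add_int, hcoord _ ⟨by linarith, by linarith⟩, sub_add_cancel]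

theorem contDiffAt_arg {z : ℂ} (hz : z ∈ Complex.slitPlane) : ContDiffAt ℝ ∞ Complex.arg z := by
  have hlog : ContDiffAt ℝ ∞ Complex.log z := (Complex.contDiffAt_log hz).restrict_scalars ℝ
  exact (Complex.imCLM.contDiff.contDiffAt.comp z hlog).congr_of_eventuallyEq
    (Filter.Eventually.of_forall fun w => (Complex.log_im w).symm)

theorem continuous_abs_arg_circle : Continuous fun z : Circle => |Complex.arg (z : ℂ)| := by
  refine continuous_iff_continuousAt.2 fun z => ?_
  simp_rw [← Complex.angle_one_left (Circle.coe_ne_zero _)]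
  exact ContinuousAt.comp (f := fun z : Circle => ((1 : ℂ), (z : ℂ)))
    (InnerProductGeometry.continuousAt_angle one_ne_zero z.coe_ne_zero)
    (Continuous.continuousAt (by fun_prop))

theorem circleFun_eventuallyEq_zero {H : ℝ → ℝ} {ε : ℝ} (hε : 0 < ε) (h0 : ∀ x ≤ ε, H x = 0)
    (h1 : ∀ x, 1 - ε ≤ x → H x = 0) {w : Circle} (hw : (w : ℂ) ∉ Complex.slitPlane) :
    circleFun H =ᶠ[nhds w] fun _ => 0 := by
  have hpi := Real.pi_pos
  have harg : Complex.arg w = Real.pi := by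
    by_contra h
    exact hw (Complex.mem_slitPlane_iff_arg.2 ⟨h, w.coe_ne_zero⟩)
  have hev : ∀ᶠ z : Circle in nhds w, Real.pi * (1 - 2 * ε) < |Complex.arg z| := by
    refine continuous_abs_arg_circle.continuousAt.eventually (lt_mem_nhds ?_)
    beta_reduce
    rw [harg, abs_of_pos hpi]
    nlinarith
  filter_upwards [hev] with z hz
  rw [circleFun]
  rcases lt_abs.1 hz with hpos | hneg
  · apply h1
    rw [← sub_le_iff_le_add, le_div_iff₀ (by positivity)]
    linarith
  · apply h0
    rw [← le_sub_iff_add_le, div_le_iff₀ (by positivity)]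
    linarith

theorem contMDiff_circleFun {H : ℝ → ℝ} (hH : ContDiff ℝ ∞ H) {ε : ℝ} (hε : 0 < ε)
    (h0 : ∀ x ≤ ε, H x = 0) (h1 : ∀ x, 1 - ε ≤ x → H x = 0) :
    ContMDiff (𝓡 1) 𝓘(ℝ, ℝ) ∞ (circleFun H) := by
  have hcoe : ContMDiff (𝓡 1) 𝓘(ℝ, ℂ) ∞ (fun w : Circle => (w : ℂ)) :=
    haveI := finrank_real_complex_fact'
    contMDiff_coe_sphere
  intro w
  by_cases hw : (w : ℂ) ∈ Complex.slitPlane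
  · have hsmooth : ContDiffAt ℝ ∞ (fun z : ℂ => H (Complex.arg z / (2 * Real.pi) + 1 / 2)) w :=
      hH.contDiffAt.comp (w : ℂ) (((contDiffAt_arg hw).div_const _).add contDiffAt_const)
    exact hsmooth.contMDiffAt.comp w (hcoe w)
  · exact contMDiffAt_const.congr_of_eventuallyEq (circleFun_eventuallyEq_zero hε h0 h1 hw)

/-- A smooth function on the circle whose values at dyadic points are uniformly computable. -/
structure IsTameOnCircle (G : Circle → ℝ) : Prop where
  smooth : ContMDiff (𝓡 1) 𝓘(ℝ, ℝ) ∞ G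
  computable : IsComputableReal fun i : ℕ × ℕ => G (circlePt ((i.2 : ℝ) / 2 ^ i.1))

theorem exists_bound_of_continuous_circle {G : Circle → ℝ} (hG : Continuous G) :
    ∃ B, ∀ w, |G w| ≤ B := by
  obtain ⟨B, hB⟩ := isCompact_univ.exists_bound_of_continuousOn hG.continuousOn
  exact ⟨B, fun w => hB w trivial⟩

theorem exists_lipschitzWith_of_contMDiff_circle {G : Circle → ℝ}
    (hG : ContMDiff (𝓡 1) 𝓘(ℝ, ℝ) ∞ G) : ∃ K, LipschitzWith K fun θ => G (circlePt θ) := by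
  set g : ℝ → ℝ := fun θ => G (circlePt θ)
  have hg : ContDiff ℝ ∞ g := contMDiff_iff_contDiff.1 (hG.comp contMDiff_circlePt)
  have hper : Function.Periodic g 1 := fun θ => by
    have hθ := circlePt_add_int θ 1
    rw [Int.cast_one] at hθ
    exact congrArg G hθ
  have hper' : Function.Periodic (deriv g) 1 := fun θ => by
    rw [← deriv_comp_add_const, funext hper]
  have hcont : Continuous (deriv g) := hg.continuous_deriv (by exact_mod_cast le_top)
  obtain ⟨B, hB⟩ := (hper'.isBounded_of_continuous one_ne_zero hcont).exists_norm_le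
  refine ⟨B.toNNReal, lipschitzWith_of_nnnorm_deriv_le (hg.differentiable (by simp)) fun θ => ?_⟩
  rw [← NNReal.coe_le_coe, coe_nnnorm]
  exact (hB _ (Set.mem_range_self θ)).trans (Real.le_coe_toNNReal B)

theorem isComputableRat_fract_dyadic :
    IsComputableRat fun i : ℕ × ℕ => Int.fract ((i.2 : ℝ) / 2 ^ i.1 + 1 / 2) := by
  have hpow : Computable fun i : ℕ × ℕ => 2 ^ i.1 :=
    primrec_nat_pow.to_comp.comp (Computable.const 2) Computable.fst
  have hdyadic := (IsComputableRat.natCast Computable.snd).div (IsComputableRat.natCast hpow)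
    fun i => by positivity
  convert (hdyadic.add (IsComputableRat.const (1 / 2))).fract (fun i => by positivity) using 3
  push_cast
  rfl

theorem isTameOnCircle_circleFun {H : ℝ → ℝ} (hH : ContDiff ℝ ∞ H) {ε : ℝ} (hε : 0 < ε)
    (h0 : ∀ x ≤ ε, H x = 0) (h1 : ∀ x, 1 - ε ≤ x → H x = 0)
    (hc : ∀ w : ℕ × ℕ → ℝ, IsComputableRat w → (∀ i, w i ∈ Set.Icc 0 1) →
      IsComputableReal fun i => H (w i)) :
    IsTameOnCircle (circleFun H) := by
  refine ⟨contMDiff_circleFun hH hε h0 h1, ?_⟩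
  have h01 : H 0 = H 1 := by rw [h0 0 hε.le, h1 1 (by linarith)]
  simp_rw [circleFun_circlePt h01]
  exact hc _ isComputableRat_fract_dyadic fun i => ⟨Int.fract_nonneg _, (Int.fract_lt_one _).le⟩

/-- A smooth function that is `1` for `a + 1 ≤ s x ≤ b - 1` and `0` unless `a < s x < b`. -/
noncomputable def plateau (s a b : ℚ) (x : ℝ) : ℝ :=
  Real.smoothTransition (s * x - a) * Real.smoothTransition (b - s * x)

theorem contDiff_plateau (s a b : ℚ) : ContDiff ℝ ∞ (plateau s a b) :=
  (Real.smoothTransition.contDiff.comp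
    ((contDiff_const.mul contDiff_id).sub contDiff_const)).mul
      (Real.smoothTransition.contDiff.comp (contDiff_const.sub (contDiff_const.mul contDiff_id)))

section plateau

variable {s a b : ℚ} {x : ℝ}

theorem plateau_eq_one (h : a + 1 ≤ s * x) (h' : s * x ≤ b - 1) : plateau s a b x = 1 := by
  rw [plateau, Real.smoothTransition.one_of_one_le (by linarith),
    Real.smoothTransition.one_of_one_le (by linarith), mul_one]

theorem plateau_eq_zero_of_le (h : s * x ≤ a) : plateau s a b x = 0 := by
  rw [plateau, Real.smoothTransition.zero_of_nonpos (sub_nonpos.2 h), zero_mul]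

theorem plateau_eq_zero_of_ge (h : b ≤ s * x) : plateau s a b x = 0 := by
  rw [plateau, Real.smoothTransition.zero_of_nonpos (sub_nonpos.2 h), mul_zero]

theorem plateau_eq_zero_of_le_inv (hs : 0 < s) (ha : 1 ≤ a) (hx : x ≤ (s : ℝ)⁻¹) :
    plateau s a b x = 0 := by
  have hs' : (0 : ℝ) < s := Rat.cast_pos.2 hs
  have ha' : (1 : ℝ) ≤ a := by exact_mod_cast ha
  refine plateau_eq_zero_of_le ?_
  calc s * x ≤ s * (s : ℝ)⁻¹ := by gcongr
    _ = 1 := mul_inv_cancel₀ hs'.ne'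
    _ ≤ a := ha'

theorem plateau_eq_zero_of_one_sub_inv_le (hs : 0 < s) (hb : b + 1 ≤ s)
    (hx : 1 - (s : ℝ)⁻¹ ≤ x) : plateau s a b x = 0 := by
  have hs' : (0 : ℝ) < s := Rat.cast_pos.2 hs
  have hb' : (b : ℝ) + 1 ≤ s := by exact_mod_cast hb
  refine plateau_eq_zero_of_ge ?_
  calc (b : ℝ) ≤ s * 1 - s * (s : ℝ)⁻¹ := by rw [mul_inv_cancel₀ hs'.ne']; linarith
    _ = s * (1 - (s : ℝ)⁻¹) := (mul_sub _ _ _).symm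
    _ ≤ s * x := by gcongr

end plateau

theorem abs_smoothTransition_le_one (x : ℝ) : |Real.smoothTransition x| ≤ 1 := by
  rw [abs_of_nonneg (Real.smoothTransition.nonneg _)]
  exact Real.smoothTransition.le_one _

theorem abs_plateau_le_one (s a b : ℚ) (x : ℝ) : |plateau s a b x| ≤ 1 := by
  rw [plateau, abs_mul]
  exact mul_le_one₀ (abs_smoothTransition_le_one _) (abs_nonneg _) (abs_smoothTransition_le_one _)

theorem IsComputableRat.plateau {ι : Type*} [Primcodable ι] {v : ι → ℝ} (hv : IsComputableRat v)
    (s a b : ℚ) : IsComputableReal fun i => plateau s a b (v i) :=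
  (((const s).mul hv).sub (const a)).smoothTransition.mul
    ((const b).sub ((const s).mul hv)).smoothTransition
    (fun _ => abs_smoothTransition_le_one _) fun _ => abs_smoothTransition_le_one _

theorem isTameOnCircle_plateau {s a b : ℚ} (hs : 0 < s) (ha : 1 ≤ a) (hb : b + 1 ≤ s) :
    IsTameOnCircle (circleFun (plateau s a b)) :=
  isTameOnCircle_circleFun (contDiff_plateau s a b) (inv_pos.2 (Rat.cast_pos.2 hs))
    (fun _ => plateau_eq_zero_of_le_inv hs ha) (fun _ => plateau_eq_zero_of_one_sub_inv_le hs hb)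
    fun _ hw _ => hw.plateau s a b

/-- The bump function that detects the first digit `j` in base `β`. -/
noncomputable def digitBump (β j : ℕ) : Circle → ℝ :=
  circleFun (plateau (4 * β) (2 * β + 4 * j - 1) (2 * β + 4 * j + 2))

theorem isTameOnCircle_digitBump {β j : ℕ} (h : 4 * j + 3 ≤ 2 * β) :
    IsTameOnCircle (digitBump β j) := by
  have h' : 4 * (j : ℚ) + 3 ≤ 2 * β := by exact_mod_cast h
  have hj := Nat.cast_nonneg (α := ℚ) j
  exact isTameOnCircle_plateau (by linarith [hj]) (by linarith [hj]) (by linarith)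

theorem digitBump_circlePt {β j i : ℕ} (hj : 4 * j + 3 ≤ 2 * β) (hi : 4 * i + 3 ≤ 2 * β) {v : ℝ}
    (hv0 : 0 ≤ v) (hv1 : v ≤ 1 / 4) :
    digitBump β j (circlePt ((i + v) / β)) = if i = j then 1 else 0 := by
  have hβ : (0 : ℝ) < β := by exact_mod_cast (by omega : 0 < β)
  have hβ' : (0 : ℚ) < 4 * β := by exact_mod_cast (by omega : 0 < 4 * β)
  have hi' : 4 * (i : ℝ) + 3 ≤ 2 * β := by exact_mod_cast hi
  have hj' : 4 * (j : ℚ) + 3 ≤ 2 * β := by exact_mod_cast hj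
  have hj0 : (0 : ℚ) ≤ j := Nat.cast_nonneg j
  have hs : (0 : ℝ) < ((4 * β : ℚ) : ℝ)⁻¹ := inv_pos.2 (Rat.cast_pos.2 hβ')
  have hhalf : ((i : ℝ) + v) / β < 1 / 2 := by
    rw [div_lt_iff₀ hβ]; linarith
  have hfract : Int.fract (((i : ℝ) + v) / β + 1 / 2) = ((i : ℝ) + v) / β + 1 / 2 :=
    Int.fract_eq_self.2 ⟨by positivity, by linarith⟩
  have hscale : ((4 * β : ℚ) : ℝ) * (((i : ℝ) + v) / β + 1 / 2) = 4 * (i + v) + 2 * β := by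
    push_cast; field_simp; ring
  have h01 : plateau (4 * β) (2 * β + 4 * j - 1) (2 * β + 4 * j + 2) 0 =
      plateau (4 * β) (2 * β + 4 * j - 1) (2 * β + 4 * j + 2) 1 := by
    rw [plateau_eq_zero_of_le_inv hβ' (by linarith) hs.le,
      plateau_eq_zero_of_one_sub_inv_le hβ' (by linarith) (by linarith)]
  rw [digitBump, circleFun_circlePt h01, hfract]
  split_ifs with hij
  · subst hij
    apply plateau_eq_one <;> rw [hscale] <;> push_cast <;> linarith
  · rcases lt_or_gt_of_ne hij with h | h
    · have h' : (i : ℝ) + 1 ≤ j := by exact_mod_cast h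
      apply plateau_eq_zero_of_le
      rw [hscale]; push_cast; linarith
    · have h' : (j : ℝ) + 1 ≤ i := by exact_mod_cast h
      apply plateau_eq_zero_of_ge
      rw [hscale]; push_cast; linarith

/-- A smooth function on the circle that coincides with the coordinate `θ` for `0 ≤ θ ≤ 1/4`. -/
noncomputable def coordFun : Circle → ℝ := circleFun fun x => (x - 1 / 2) * plateau 8 3 7 x

theorem plateau_eight_of_le {x : ℝ} (hx : x ≤ 1 / 8) : plateau 8 3 7 x = 0 :=
  plateau_eq_zero_of_le_inv (by norm_num) (by norm_num) (hx.trans (by norm_num))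

theorem plateau_eight_of_ge {x : ℝ} (hx : 1 - 1 / 8 ≤ x) : plateau 8 3 7 x = 0 :=
  plateau_eq_zero_of_one_sub_inv_le (by norm_num) (by norm_num) (le_trans (by norm_num) hx)

theorem isTameOnCircle_coordFun : IsTameOnCircle coordFun := by
  refine isTameOnCircle_circleFun ((contDiff_id.sub contDiff_const).mul (contDiff_plateau 8 3 7))
    (ε := 1 / 8) (by norm_num) (fun x hx => ?_) (fun x hx => ?_) fun w hw hw01 => ?_
  · rw [plateau_eight_of_le hx, mul_zero]
  · rw [plateau_eight_of_ge hx, mul_zero]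
  · have hsub : IsComputableRat fun i => w i - 1 / 2 := by
      simpa using hw.sub (IsComputableRat.const (1 / 2))
    refine hsub.isComputableReal.mul (hw.plateau 8 3 7) (B := 1) (fun i => ?_)
      fun i => abs_plateau_le_one _ _ _ _
    obtain ⟨hlo, hhi⟩ := hw01 i
    exact abs_le.2 ⟨by linarith, by linarith⟩

theorem coordFun_circlePt {θ : ℝ} (h0 : 0 ≤ θ) (h1 : θ ≤ 1 / 4) : coordFun (circlePt θ) = θ := by
  have hfract : Int.fract (θ + 1 / 2) = θ + 1 / 2 :=
    Int.fract_eq_self.2 ⟨by linarith, by linarith⟩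
  rw [coordFun, circleFun_circlePt, hfract, plateau_eq_one, mul_one, add_sub_cancel_right]
  · push_cast; linarith
  · push_cast; linarith
  · rw [plateau_eight_of_le (by norm_num), plateau_eight_of_ge (by norm_num), mul_zero, mul_zero]

/-! ### Shears of the torus -/

/-- Quadruples, grouped as in `Torus4`. -/
abbrev Quad (α : Type*) : Type _ := (α × α) × (α × α)

/-- The `j`-th coordinate of a quadruple. -/
def coordAt {α : Type*} (j : Fin 4) (z : Quad α) : α :=
  match j with
  | 0 => z.1.1
  | 1 => z.1.2
  | 2 => z.2.1
  | 3 => z.2.2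

/-- The quadruple with prescribed coordinates. -/
def ofCoords {α : Type*} (f : Fin 4 → α) : Quad α := ((f 0, f 1), (f 2, f 3))

/-- Replacement of the `i`-th coordinate of a quadruple. -/
def setAt {α : Type*} (i : Fin 4) (w : α) (z : Quad α) : Quad α :=
  ofCoords fun j => if j = i then w else coordAt j z

section Quad

variable {α β : Type*}

theorem coordAt_ofCoords (j : Fin 4) (f : Fin 4 → α) : coordAt j (ofCoords f) = f j := by
  fin_cases j <;> rfl

theorem ext_coordAt {z z' : Quad α} (h : ∀ j, coordAt j z = coordAt j z') : z = z' :=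
  Prod.ext (Prod.ext (h 0) (h 1)) (Prod.ext (h 2) (h 3))

theorem coordAt_setAt (i j : Fin 4) (w : α) (z : Quad α) :
    coordAt j (setAt i w z) = if j = i then w else coordAt j z :=
  coordAt_ofCoords _ _

theorem coordAt_setAt_self (i : Fin 4) (w : α) (z : Quad α) : coordAt i (setAt i w z) = w :=
  (coordAt_setAt _ _ _ _).trans (if_pos rfl)

theorem coordAt_setAt_of_ne {i j : Fin 4} (h : j ≠ i) (w : α) (z : Quad α) :
    coordAt j (setAt i w z) = coordAt j z :=
  (coordAt_setAt _ _ _ _).trans (if_neg h)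

theorem setAt_setAt (i : Fin 4) (w w' : α) (z : Quad α) :
    setAt i w (setAt i w' z) = setAt i w z :=
  ext_coordAt fun j => by
    simp only [coordAt_setAt]
    split_ifs <;> rfl

theorem setAt_coordAt (i : Fin 4) (z : Quad α) : setAt i (coordAt i z) z = z :=
  ext_coordAt fun j => by
    rw [coordAt_setAt]
    split_ifs with h
    exacts [h ▸ rfl, rfl]

theorem setAt_comm {i j : Fin 4} (h : i ≠ j) (w w' : α) (z : Quad α) :
    setAt i w (setAt j w' z) = setAt j w' (setAt i w z) :=
  ext_coordAt fun l => by
    simp only [coordAt_setAt]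
    split_ifs with hi hj
    exacts [absurd (hi.symm.trans hj) h, rfl, rfl, rfl]

theorem dist_quad_le_iff [PseudoMetricSpace α] {z z' : Quad α} {r : ℝ} :
    dist z z' ≤ r ↔ ∀ j, dist (coordAt j z) (coordAt j z') ≤ r := by
  simp [Prod.dist_eq, Fin.forall_fin_succ, coordAt, and_assoc]

theorem lipschitzWith_coordAt [PseudoMetricSpace α] (j : Fin 4) :
    LipschitzWith 1 (coordAt j : Quad α → α) :=
  LipschitzWith.of_dist_le_mul fun z z' => by
    rw [NNReal.coe_one, one_mul]
    exact dist_quad_le_iff.1 le_rfl j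

theorem lipschitzWith_of_coordAt [PseudoMetricSpace α] [PseudoMetricSpace β] {f : β → Quad α}
    {K : NNReal} (h : ∀ j, LipschitzWith K fun x => coordAt j (f x)) : LipschitzWith K f :=
  LipschitzWith.of_dist_le_mul fun x y => dist_quad_le_iff.2 fun j => (h j).dist_le_mul x y

theorem computable_coordAt [Primcodable α] (j : Fin 4) :
    Computable (coordAt j : Quad α → α) := by
  fin_cases j
  · exact Computable.fst.comp Computable.fst
  · exact Computable.snd.comp Computable.fst
  · exact Computable.fst.comp Computable.snd
  · exact Computable.snd.comp Computable.snd

theorem computable_ofCoords [Primcodable α] [Primcodable β] {f : Fin 4 → α → β}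
    (hf : ∀ j, Computable (f j)) : Computable fun x => ofCoords fun j => f j x :=
  ((hf 0).pair (hf 1)).pair ((hf 2).pair (hf 3))

end Quad

theorem contMDiff_coordAt (j : Fin 4) :
    ContMDiff torus4Model (𝓡 1) ∞ (coordAt j : Torus4 → Circle) := by
  have hfst : ContMDiff torus4Model ((𝓡 1).prod (𝓡 1)) ∞ fun z : Torus4 => z.1 := contMDiff_fst
  have hsnd : ContMDiff torus4Model ((𝓡 1).prod (𝓡 1)) ∞ fun z : Torus4 => z.2 := contMDiff_snd
  fin_cases j
  exacts [hfst.fst, hfst.snd, hsnd.fst, hsnd.snd]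

theorem contMDiff_of_coordAt {F : Torus4 → Torus4}
    (h : ∀ j, ContMDiff torus4Model (𝓡 1) ∞ fun z => coordAt j (F z)) :
    ContMDiff torus4Model torus4Model ∞ F :=
  ((h 0).prodMk (h 1)).prodMk ((h 2).prodMk (h 3))

theorem contMDiff_setAt (i : Fin 4) {W : Torus4 → Circle}
    (hW : ContMDiff torus4Model (𝓡 1) ∞ W) :
    ContMDiff torus4Model torus4Model ∞ fun z => setAt i (W z) z := by
  refine contMDiff_of_coordAt fun j => ?_
  simp only [coordAt_setAt]
  split_ifs
  exacts [hW, contMDiff_coordAt j]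

theorem coordAt_toTorus4 (j : Fin 4) (x : Quad ℝ) :
    coordAt j (toTorus4 x) = circlePt (coordAt j x) := by
  fin_cases j <;> rfl

theorem coordAt_dyadic (j : Fin 4) (p : ℕ) (a : Quad ℕ) :
    coordAt j (dyadic p a) = ((coordAt j a : ℕ) : ℝ) / 2 ^ p := by
  fin_cases j <;> rfl

theorem coordAt_dyadic_nonneg (j : Fin 4) (p : ℕ) (a : Quad ℕ) : 0 ≤ coordAt j (dyadic p a) := by
  rw [coordAt_dyadic]
  positivity

theorem isComputableReal_coordAt_dyadic (j : Fin 4) :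
    IsComputableReal fun i : ℕ × Quad ℕ => coordAt j (dyadic i.1 i.2) := by
  have hpow : Computable fun i : ℕ × Quad ℕ => 2 ^ i.1 :=
    primrec_nat_pow.to_comp.comp (Computable.const 2) Computable.fst
  have hdiv := (IsComputableRat.natCast ((computable_coordAt j).comp Computable.snd)).div
    (IsComputableRat.natCast hpow) fun i => by positivity
  convert hdiv.isComputableReal using 2 with i
  rw [coordAt_dyadic]
  push_cast
  rfl

/-- A smooth function on the torus whose values at dyadic points are uniformly computable,
together with the bounds that make such functions an algebra. -/
structure IsTame (Γ : Torus4 → ℝ) : Prop where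
  smooth : ContMDiff torus4Model 𝓘(ℝ, ℝ) ∞ Γ
  bounded : ∃ B, ∀ z, |Γ z| ≤ B
  lipschitz : ∃ K, LipschitzWith K fun x => Γ (toTorus4 x)
  computable : IsComputableReal fun i : ℕ × Quad ℕ => Γ (toTorus4 (dyadic i.1 i.2))

namespace IsTame

variable {Γ Δ : Torus4 → ℝ}

theorem const (q : ℚ) : IsTame fun _ => (q : ℝ) :=
  ⟨contMDiff_const, ⟨_, fun _ => le_rfl⟩, ⟨0, LipschitzWith.const _⟩, IsComputableReal.const q⟩

theorem neg (h : IsTame Γ) : IsTame fun z => -Γ z := by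
  obtain ⟨B, hB⟩ := h.bounded
  obtain ⟨K, hK⟩ := h.lipschitz
  exact ⟨contDiff_neg.contMDiff.comp h.smooth, ⟨B, fun z => by rw [abs_neg]; exact hB z⟩,
    ⟨K, hK.neg⟩, h.computable.neg⟩

theorem add (h : IsTame Γ) (h' : IsTame Δ) : IsTame fun z => Γ z + Δ z := by
  obtain ⟨B, hB⟩ := h.bounded
  obtain ⟨K, hK⟩ := h.lipschitz
  obtain ⟨B', hB'⟩ := h'.bounded
  obtain ⟨K', hK'⟩ := h'.lipschitz
  exact ⟨h.smooth.add h'.smooth, ⟨B + B', fun z => (abs_add_le _ _).trans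
    (add_le_add (hB z) (hB' z))⟩, ⟨_, hK.add hK'⟩, h.computable.add h'.computable⟩

theorem mul (h : IsTame Γ) (h' : IsTame Δ) : IsTame fun z => Γ z * Δ z := by
  obtain ⟨B, hB⟩ := h.bounded
  obtain ⟨K, hK⟩ := h.lipschitz
  obtain ⟨B', hB'⟩ := h'.bounded
  obtain ⟨K', hK'⟩ := h'.lipschitz
  have hB0 : 0 ≤ B := (abs_nonneg _).trans (hB (toTorus4 0))
  have hB0' : 0 ≤ B' := (abs_nonneg _).trans (hB' (toTorus4 0))
  refine ⟨h.smooth.mul h'.smooth, ⟨B * B', fun z => ?_⟩,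
    ⟨B.toNNReal * K' + B'.toNNReal * K, LipschitzWith.of_dist_le_mul fun x y => ?_⟩,
    h.computable.mul h'.computable (fun i => hB _) fun i => hB' _⟩
  · rw [abs_mul]
    exact mul_le_mul (hB z) (hB' z) (abs_nonneg _) hB0
  · have hΓ := hK.dist_le_mul x y
    have hΔ := hK'.dist_le_mul x y
    rw [Real.dist_eq] at hΓ hΔ ⊢
    push_cast
    rw [Real.coe_toNNReal B hB0, Real.coe_toNNReal B' hB0']
    calc |Γ (toTorus4 x) * Δ (toTorus4 x) - Γ (toTorus4 y) * Δ (toTorus4 y)|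
        = |Γ (toTorus4 x) * (Δ (toTorus4 x) - Δ (toTorus4 y)) +
            Δ (toTorus4 y) * (Γ (toTorus4 x) - Γ (toTorus4 y))| := by ring_nf
      _ ≤ |Γ (toTorus4 x)| * |Δ (toTorus4 x) - Δ (toTorus4 y)| +
            |Δ (toTorus4 y)| * |Γ (toTorus4 x) - Γ (toTorus4 y)| := by
          rw [← abs_mul, ← abs_mul]; exact abs_add_le _ _
      _ ≤ B * (K' * dist x y) + B' * (K * dist x y) := by
          gcongr
          · exact hB _
          · exact hB' _
      _ = _ := by ring

theorem sum {σ : Type*} (s : Finset σ) {F : σ → Torus4 → ℝ} (h : ∀ a ∈ s, IsTame (F a)) :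
    IsTame fun z => ∑ a ∈ s, F a z := by
  classical
  induction s using Finset.induction_on with
  | empty => simpa using const 0
  | insert a s ha ih =>
    simp only [Finset.sum_insert ha]
    exact (h a (Finset.mem_insert_self a s)).add
      (ih fun b hb => h b (Finset.mem_insert_of_mem hb))

theorem coord {G : Circle → ℝ} (hG : IsTameOnCircle G) (j : Fin 4) :
    IsTame fun z => G (coordAt j z) := by
  obtain ⟨B, hB⟩ := exists_bound_of_continuous_circle hG.smooth.continuous
  obtain ⟨K, hK⟩ := exists_lipschitzWith_of_contMDiff_circle hG.smooth
  refine ⟨hG.smooth.comp (contMDiff_coordAt j), ⟨B, fun z => hB _⟩, ⟨K * 1, ?_⟩, ?_⟩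
  · simp only [coordAt_toTorus4]
    exact hK.comp (lipschitzWith_coordAt j)
  · simp only [coordAt_toTorus4, coordAt_dyadic]
    have hindex : Computable fun i : ℕ × Quad ℕ => (i.1, coordAt j i.2) :=
      Computable.fst.pair ((computable_coordAt j).comp Computable.snd)
    simpa only using hG.computable.comp hindex

end IsTame

/-- A self-map of the torus with a Lipschitz lift whose values at dyadic points are computable.
The lift preserves nonnegativity because the grid `dyadic p` consists of nonnegative points. -/
def HasComputableLift (F : Torus4 → Torus4) : Prop :=
  ∃ f : Quad ℝ → Quad ℝ, (∀ x, F (toTorus4 x) = toTorus4 (f x)) ∧ (∃ K, LipschitzWith K f) ∧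
    (∀ x, (∀ j, 0 ≤ coordAt j x) → ∀ j, 0 ≤ coordAt j (f x)) ∧
    ∀ j, IsComputableReal fun i : ℕ × Quad ℕ => coordAt j (f (dyadic i.1 i.2))

theorem exists_dyadic_approx {f : Quad ℝ → Quad ℝ}
    (h0 : ∀ x, (∀ j, 0 ≤ coordAt j x) → ∀ j, 0 ≤ coordAt j (f x))
    (hf : ∀ j, IsComputableReal fun i : ℕ × Quad ℕ => coordAt j (f (dyadic i.1 i.2))) :
    ∃ g : ℕ × ℕ × Quad ℕ → Quad ℕ, Computable g ∧
      ∀ p r a, dist (f (dyadic p a)) (dyadic r (g (p, r, a))) ≤ (1 / 2) ^ r := by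
  choose g hg hfg using fun j =>
    (hf j).exists_nat_approx fun i => h0 _ (coordAt_dyadic_nonneg · i.1 i.2) j
  have hindex : Computable fun x : ℕ × ℕ × Quad ℕ => ((x.1, x.2.2), x.2.1) :=
    (Computable.fst.pair (Computable.snd.comp Computable.snd)).pair
      (Computable.fst.comp Computable.snd)
  refine ⟨fun x => ofCoords fun j => g j ((x.1, x.2.2), x.2.1),
    computable_ofCoords fun j => (hg j).comp hindex, fun p r a => dist_quad_le_iff.2 fun j => ?_⟩
  rw [coordAt_dyadic, coordAt_ofCoords]
  exact hfg j (p, a) r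

namespace HasComputableLift

variable {F G : Torus4 → Torus4}

theorem isComputableTorusMap (h : HasComputableLift F) : IsComputableTorusMap F := by
  obtain ⟨f, hf, -, h0, hc⟩ := h
  obtain ⟨g, hg, hfg⟩ := exists_dyadic_approx h0 hc
  exact ⟨g, hg, fun p r a => ⟨_, hf _, hfg p r a⟩⟩

theorem comp (hG : HasComputableLift G) (hF : HasComputableLift F) :
    HasComputableLift (G ∘ F) := by
  obtain ⟨f, hf, ⟨K, hK⟩, hf0, hfj⟩ := hF
  obtain ⟨g, hg, ⟨K', hK'⟩, hg0, hgc⟩ := hG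
  obtain ⟨c, hc, hfc⟩ := exists_dyadic_approx hf0 hfj
  refine ⟨g ∘ f, fun x => by simp only [Function.comp_apply, hf, hg], ⟨_, hK'.comp hK⟩,
    fun x hx => hg0 _ (hf0 x hx), fun j => ?_⟩
  obtain ⟨x, hx, hgx⟩ := hgc j
  have hindex : Computable fun y : (ℕ × Quad ℕ) × ℕ => ((y.2, c (y.1.1, y.2, y.1.2)), y.2) :=
    (Computable.snd.pair (hc.comp ((Computable.fst.comp Computable.fst).pair
      (Computable.snd.pair (Computable.snd.comp Computable.fst))))).pair Computable.snd
  refine IsComputableReal.of_abs_sub_le (hx.comp hindex) (K' + 1) fun i r => ?_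
  dsimp only [Function.comp_apply]
  generalize hz : f (dyadic i.1 i.2) = z
  generalize hy : c (i.1, r, i.2) = y
  have hzy : dist z (dyadic r y) ≤ (1 / 2) ^ r := by
    rw [← hz, ← hy]
    exact hfc _ _ _
  have hlip : |coordAt j (g z) - coordAt j (g (dyadic r y))| ≤ K' * dist z (dyadic r y) := by
    rw [← Real.dist_eq]
    exact dist_quad_le_iff.1 (hK'.dist_le_mul _ _) j
  calc |coordAt j (g z) - x ((r, y), r)|
      ≤ |coordAt j (g z) - coordAt j (g (dyadic r y))| +
        |coordAt j (g (dyadic r y)) - x ((r, y), r)| := abs_sub_le _ _ _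
    _ ≤ K' * (1 / 2) ^ r + (1 / 2) ^ r :=
      add_le_add (hlip.trans (by gcongr)) (hgx (r, y) r)
    _ = (K' + 1) * (1 / 2) ^ r := by ring

end HasComputableLift

/-- The shear that adds the function `Γ` to the `i`-th coordinate. -/
noncomputable def shearMap (i : Fin 4) (Γ : Torus4 → ℝ) (z : Torus4) : Torus4 :=
  setAt i (circlePt (Γ z) * coordAt i z) z

theorem shearMap_eq {i : Fin 4} {z : Torus4} {x : ℝ} (h : coordAt i z = circlePt x)
    (Γ : Torus4 → ℝ) : shearMap i Γ z = setAt i (circlePt (Γ z + x)) z := by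
  rw [shearMap, h, circlePt_add]

theorem contMDiff_shearMap (i : Fin 4) {Γ : Torus4 → ℝ} (hΓ : ContMDiff torus4Model 𝓘(ℝ, ℝ) ∞ Γ) :
    ContMDiff torus4Model torus4Model ∞ (shearMap i Γ) :=
  contMDiff_setAt i ((contMDiff_circlePt.comp hΓ).mul (contMDiff_coordAt i))

/-- An integer is added to `Γ` to make the lift preserve nonnegativity. -/
theorem hasComputableLift_shearMap (i : Fin 4) {Γ : Torus4 → ℝ} (hΓ : IsTame Γ) :
    HasComputableLift (shearMap i Γ) := by
  obtain ⟨B, hB⟩ := hΓ.bounded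
  obtain ⟨K, hK⟩ := hΓ.lipschitz
  obtain ⟨N, hN⟩ := exists_nat_ge B
  have hpos : ∀ z, 0 ≤ Γ z + N := fun z => by linarith [(abs_le.1 (hB z)).1]
  refine ⟨fun x => setAt i (Γ (toTorus4 x) + N + coordAt i x) x, fun x => ext_coordAt fun j => ?_,
    ⟨K + 0 + 1, lipschitzWith_of_coordAt fun j => ?_⟩, fun x hx j => ?_, fun j => ?_⟩
  all_goals simp only [shearMap, coordAt_toTorus4, coordAt_setAt]
  all_goals split_ifs
  · rw [circlePt_add, ← Int.cast_natCast, circlePt_add_int]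
  · rfl
  · exact (hK.add (LipschitzWith.const _)).add (lipschitzWith_coordAt i)
  · exact (lipschitzWith_coordAt j).weaken le_add_self
  · exact add_nonneg (hpos _) (hx i)
  · exact hx j
  · simpa using (hΓ.computable.add (IsComputableReal.const N)).add
      (isComputableReal_coordAt_dyadic i)
  · exact isComputableReal_coordAt_dyadic j

/-- A shear by a function that does not depend on the sheared coordinate, as a diffeomorphism. -/
noncomputable def shear (i : Fin 4) (Γ : Torus4 → ℝ) (hΓ : ContMDiff torus4Model 𝓘(ℝ, ℝ) ∞ Γ)
    (hi : ∀ w z, Γ (setAt i w z) = Γ z) :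
    Diffeomorph torus4Model torus4Model Torus4 Torus4 ∞ where
  toFun := shearMap i Γ
  invFun := shearMap i fun z => -Γ z
  left_inv z := by
    simp only [shearMap, hi, coordAt_setAt_self, setAt_setAt, ← mul_assoc, ← circlePt_add,
      neg_add_cancel, circlePt_zero, one_mul, setAt_coordAt]
  right_inv z := by
    simp only [shearMap, hi, coordAt_setAt_self, setAt_setAt, ← mul_assoc, ← circlePt_add,
      add_neg_cancel, circlePt_zero, one_mul, setAt_coordAt]
  contMDiff_toFun := contMDiff_shearMap i hΓ
  contMDiff_invFun := contMDiff_shearMap i (contDiff_neg.contMDiff.comp hΓ)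

/-- Diffeomorphisms of the torus with a computable Lipschitz lift. -/
def IsComputableDiffeo (F : Torus4 → Torus4) : Prop :=
  HasComputableLift F ∧ ∃ Φ : Diffeomorph torus4Model torus4Model Torus4 Torus4 ∞, ⇑Φ = F

theorem IsComputableDiffeo.comp {F G : Torus4 → Torus4} (hG : IsComputableDiffeo G)
    (hF : IsComputableDiffeo F) : IsComputableDiffeo (G ∘ F) := by
  obtain ⟨hG, Φ, rfl⟩ := hG
  obtain ⟨hF, Ψ, rfl⟩ := hF
  exact ⟨hG.comp hF, Ψ.trans Φ, rfl⟩

theorem isComputableDiffeo_shearMap (i : Fin 4) {Γ : Torus4 → ℝ} (hΓ : IsTame Γ)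
    (hi : ∀ w z, Γ (setAt i w z) = Γ z) : IsComputableDiffeo (shearMap i Γ) :=
  ⟨hasComputableLift_shearMap i hΓ, shear i Γ hΓ.smooth hi, rfl⟩

/-! ### Prefix rewriting as a diffeomorphism of the torus -/

/-- The functions `S s` single out the index `s₀` at the point `z`. -/
def Selects {σ : Type*} (S : σ → Torus4 → ℝ) (s₀ : σ) (z : Torus4) : Prop :=
  S s₀ z = 1 ∧ ∀ s ≠ s₀, S s z = 0

theorem Selects.sum_mul {σ : Type*} [Fintype σ] {S : σ → Torus4 → ℝ} {s₀ : σ} {z : Torus4}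
    (h : Selects S s₀ z) (u : σ → ℝ) : ∑ s, S s z * u s = u s₀ := by
  rw [Fintype.sum_eq_single s₀ fun s hs => by rw [h.2 s hs, zero_mul], h.1, one_mul]

/-- The coordinate number `1` is `0` before and after and serves as work space: for the selected
`y = lam x + c`, three shears perform
`(x, 0) ↦ (x, x) ↦ (x + (lam - 1) x + c, x) ↦ (y, x + lam⁻¹ (c - y)) = (y, 0)`. -/
theorem exists_selected_affine {σ : Type*} [Finite σ] {i : Fin 4} (hi : i ≠ 1)
    {S : σ → Torus4 → ℝ} (hS : ∀ s, IsTame (S s)) (hSi : ∀ s w z, S s (setAt i w z) = S s z)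
    (hS1 : ∀ s w z, S s (setAt 1 w z) = S s z) (lam c : σ → ℚ) (hlam : ∀ s, lam s ≠ 0) :
    ∃ F, IsComputableDiffeo F ∧ ∀ z s x, Selects S s z → coordAt 1 z = 1 →
      coordAt i z = circlePt x → x ∈ Set.Icc (0 : ℝ) (1 / 4) →
      lam s * x + c s ∈ Set.Icc (0 : ℝ) (1 / 4) →
      F z = setAt i (circlePt (lam s * x + c s)) z := by
  have := Fintype.ofFinite σ
  have hφ : ∀ j, IsTame fun z => coordFun (coordAt j z) := IsTame.coord isTameOnCircle_coordFun
  set Γ : Torus4 → ℝ := fun z =>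
    ∑ s, S s z * (((lam s - 1 : ℚ) : ℝ) * coordFun (coordAt 1 z) + ((c s : ℚ) : ℝ)) with hΓ
  set Δ : Torus4 → ℝ := fun z =>
    ∑ s, S s z * ((((lam s)⁻¹ : ℚ) : ℝ) * (((c s : ℚ) : ℝ) + -coordFun (coordAt i z))) with hΔ
  have hΓt : IsTame Γ := IsTame.sum _ fun s _ =>
    (hS s).mul (((IsTame.const _).mul (hφ 1)).add (IsTame.const _))
  have hΔt : IsTame Δ := IsTame.sum _ fun s _ =>
    (hS s).mul ((IsTame.const _).mul ((IsTame.const _).add (hφ i).neg))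
  refine ⟨_, (isComputableDiffeo_shearMap 1 hΔt fun w z => ?_).comp
    ((isComputableDiffeo_shearMap i hΓt fun w z => ?_).comp
      (isComputableDiffeo_shearMap 1 (hφ i) fun w z => ?_)), fun z s x hsel h1 hx hx01 hy01 => ?_⟩
  · simp only [hΔ, hS1, coordAt_setAt_of_ne hi]
  · simp only [hΓ, hSi, coordAt_setAt_of_ne hi.symm]
  · rw [coordAt_setAt_of_ne hi]
  have hl : (lam s : ℝ) ≠ 0 := Rat.cast_ne_zero.2 (hlam s)
  set y : ℝ := lam s * x + c s with hy
  have hcopy : shearMap 1 (fun z => coordFun (coordAt i z)) z = setAt 1 (circlePt x) z := by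
    rw [shearMap_eq (h1.trans circlePt_zero.symm), hx, coordFun_circlePt hx01.1 hx01.2, add_zero]
  have happly : shearMap i Γ (setAt 1 (circlePt x) z) =
      setAt i (circlePt y) (setAt 1 (circlePt x) z) := by
    rw [shearMap_eq ((coordAt_setAt_of_ne hi _ _).trans hx)]
    simp only [hΓ, hS1, hsel.sum_mul, coordAt_setAt_self, coordFun_circlePt hx01.1 hx01.2, hy]
    push_cast
    ring_nf
  have hclear : shearMap 1 Δ (setAt i (circlePt y) (setAt 1 (circlePt x) z)) =
      setAt 1 1 (setAt i (circlePt y) (setAt 1 (circlePt x) z)) := by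
    have hzero : (lam s : ℝ)⁻¹ * (c s + -y) + x = 0 := by rw [hy]; field_simp; ring
    rw [shearMap_eq ((coordAt_setAt_of_ne hi.symm _ _).trans (coordAt_setAt_self _ _ _))]
    simp only [hΔ, hSi, hS1, hsel.sum_mul, coordAt_setAt_self, coordFun_circlePt hy01.1 hy01.2,
      Rat.cast_inv, hzero, circlePt_zero]
  rw [Function.comp_apply, Function.comp_apply, hcopy, happly, hclear, setAt_comm hi.symm,
    setAt_setAt, ← h1, setAt_coordAt]

/-- The real number `∑ dg (X n) b ^ (-n - 1)` with the digits `dg (X n)` in base `b = 10 k`. -/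
noncomputable def streamVal {B : Type*} (k : ℕ) (dg : B → ℕ) (X : Stream' B) : ℝ :=
  ∑' n : ℕ, (dg (X.get n) : ℝ) / (10 * (k : ℝ)) ^ (n + 1)

/-- The value of a finite digit string. -/
def listVal {B : Type*} (k : ℕ) (dg : B → ℕ) : List B → ℚ
  | [] => 0
  | a :: l => (dg a + listVal k dg l) / (10 * k)

/-- The slope of the affine map that replaces the prefix `l` by the prefix `l'`. -/
def prefixSlope {B : Type*} (k : ℕ) (l l' : List B) : ℚ :=
  (10 * k) ^ l.length / (10 * k) ^ l'.length

/-- The constant term of the affine map that replaces the prefix `l` by the prefix `l'`. -/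
def prefixShift {B : Type*} (k : ℕ) (dg : B → ℕ) (l l' : List B) : ℚ :=
  listVal k dg l' - prefixSlope k l l' * listVal k dg l

section streamVal

variable {B : Type*} {k : ℕ} {dg : B → ℕ}

theorem streamVal_term_le (hk : 1 ≤ k) (hdg : ∀ a, dg a ≤ k) (X : Stream' B) (n : ℕ) :
    (dg (X.get n) : ℝ) / (10 * (k : ℝ)) ^ (n + 1) ≤ 1 / 10 * (1 / 10) ^ n := by
  have hk' : (1 : ℝ) ≤ k := by exact_mod_cast hk
  have hdg' : (dg (X.get n) : ℝ) ≤ k := by exact_mod_cast hdg _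
  calc (dg (X.get n) : ℝ) / (10 * (k : ℝ)) ^ (n + 1)
      ≤ (k : ℝ) ^ (n + 1) / (10 * (k : ℝ)) ^ (n + 1) := by
        gcongr
        exact hdg'.trans (le_self_pow₀ hk' n.succ_ne_zero)
    _ = 1 / 10 * (1 / 10) ^ n := by
      rw [← div_pow, div_mul_cancel_right₀ (by positivity), ← one_div, pow_succ']

theorem hasSum_one_ninth : HasSum (fun n : ℕ => (1 / 10 : ℝ) * (1 / 10) ^ n) (1 / 9) := by
  have h := (hasSum_geometric_of_lt_one (r := (1 / 10 : ℝ)) (by norm_num) (by norm_num)).mul_left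
    (1 / 10)
  norm_num at h ⊢
  exact h

theorem summable_streamVal (hk : 1 ≤ k) (hdg : ∀ a, dg a ≤ k) (X : Stream' B) :
    Summable fun n : ℕ => (dg (X.get n) : ℝ) / (10 * (k : ℝ)) ^ (n + 1) :=
  Summable.of_nonneg_of_le (fun n => by positivity) (streamVal_term_le hk hdg X)
    hasSum_one_ninth.summable

theorem streamVal_nonneg (X : Stream' B) : 0 ≤ streamVal k dg X :=
  tsum_nonneg fun n => by positivity

theorem streamVal_le (hk : 1 ≤ k) (hdg : ∀ a, dg a ≤ k) (X : Stream' B) :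
    streamVal k dg X ≤ 1 / 9 :=
  hasSum_one_ninth.tsum_eq ▸ (summable_streamVal hk hdg X).tsum_le_tsum
    (streamVal_term_le hk hdg X) hasSum_one_ninth.summable

theorem streamVal_mem_Icc (hk : 1 ≤ k) (hdg : ∀ a, dg a ≤ k) (X : Stream' B) :
    streamVal k dg X ∈ Set.Icc (0 : ℝ) (1 / 4) :=
  ⟨streamVal_nonneg X, (streamVal_le hk hdg X).trans (by norm_num)⟩

theorem streamVal_eq (hk : 1 ≤ k) (hdg : ∀ a, dg a ≤ k) (X : Stream' B) :
    streamVal k dg X = (dg X.head + streamVal k dg X.tail) / (10 * k : ℕ) := by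
  rw [streamVal, (summable_streamVal hk hdg X).tsum_eq_zero_add, add_div, zero_add, pow_one,
    streamVal, ← tsum_div_const]
  push_cast
  congr 2
  funext n
  rw [Stream'.get_tail, div_div, ← pow_succ]

theorem streamVal_eq_two (hk : 1 ≤ k) (hdg : ∀ a, dg a ≤ k) (X : Stream' B) :
    streamVal k dg X = ((dg X.head * (10 * k) + dg X.tail.head : ℕ) +
      streamVal k dg X.tail.tail) / ((10 * k) * (10 * k) : ℕ) := by
  have : (1 : ℝ) ≤ k := by exact_mod_cast hk
  rw [streamVal_eq hk hdg, streamVal_eq hk hdg X.tail]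
  push_cast
  field_simp
  ring

theorem streamVal_append (hk : 1 ≤ k) (hdg : ∀ a, dg a ≤ k) (l : List B) (X : Stream' B) :
    streamVal k dg (l ++ₛ X) = listVal k dg l + streamVal k dg X / (10 * k) ^ l.length := by
  have : (1 : ℝ) ≤ k := by exact_mod_cast hk
  induction l with
  | nil => simp [listVal]
  | cons a l ih =>
    rw [Stream'.cons_append_stream, streamVal_eq hk hdg, Stream'.head_cons, Stream'.tail_cons, ih,
      listVal, List.length_cons, pow_succ]
    push_cast
    field_simp
    ring

theorem prefixSlope_ne_zero (hk : 1 ≤ k) (l l' : List B) : prefixSlope k l l' ≠ 0 := by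
  have : (k : ℚ) ≠ 0 := Nat.cast_ne_zero.2 (Nat.one_le_iff_ne_zero.1 hk)
  rw [prefixSlope]
  positivity

theorem streamVal_replace (hk : 1 ≤ k) (hdg : ∀ a, dg a ≤ k) (l l' : List B) (X : Stream' B) :
    streamVal k dg (l' ++ₛ X) =
      prefixSlope k l l' * streamVal k dg (l ++ₛ X) + prefixShift k dg l l' := by
  have : (1 : ℝ) ≤ k := by exact_mod_cast hk
  rw [streamVal_append hk hdg, streamVal_append hk hdg, prefixShift, prefixSlope]
  push_cast
  field_simp
  ring

end streamVal

/-- The rewriting step on pairs of streams that replaces the first two letters of the left stream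
and the first letter of the right stream according to the rule `G`. -/
def rewriteStep {B : Type*} (G : B → B → B → List B × List B) (c : Stream' B × Stream' B) :
    Stream' B × Stream' B :=
  ((G c.1.head c.1.tail.head c.2.head).1 ++ₛ c.1.tail.tail,
    (G c.1.head c.1.tail.head c.2.head).2 ++ₛ c.2.tail)

/-- The letters that a rewriting step looks at. -/
def window {B : Type*} (c : Stream' B × Stream' B) : B × B × B :=
  (c.1.head, c.1.tail.head, c.2.head)

/-- The point of the torus that represents a pair of streams. The coordinate `t` is the history of
the earlier rewriting steps, which makes the steps invertible; the second one is work space. -/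
noncomputable def streamPoint {B : Type*} (k : ℕ) (dg : B → ℕ) (t : ℝ)
    (c : Stream' B × Stream' B) : Torus4 :=
  ((circlePt t, 1), (circlePt (streamVal k dg c.2), circlePt (streamVal k dg c.1)))

/-- The functions that detect the window of a pair of streams. -/
noncomputable def windowBump {B : Type*} (k : ℕ) (dg : B → ℕ) (s : B × B × B) (z : Torus4) : ℝ :=
  digitBump ((10 * k) * (10 * k)) (dg s.1 * (10 * k) + dg s.2.1) (coordAt 3 z) *
    digitBump (10 * k) (dg s.2.2) (coordAt 2 z)

section rewriteStep

variable {B : Type*} {k : ℕ} {dg : B → ℕ}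

theorem four_mul_digit_add_three_le (hk : 1 ≤ k) (hdg : ∀ a, dg a ≤ k) (a : B) :
    4 * dg a + 3 ≤ 2 * (10 * k) := by
  linarith [hdg a]

theorem four_mul_two_digits_add_three_le (hk : 1 ≤ k) (hdg : ∀ a, dg a ≤ k) (a a' : B) :
    4 * (dg a * (10 * k) + dg a') + 3 ≤ 2 * ((10 * k) * (10 * k)) := by
  have hle : dg a * (10 * k) ≤ k * (10 * k) := Nat.mul_le_mul_right _ (hdg a)
  nlinarith [hdg a']

theorem isTame_windowBump (hk : 1 ≤ k) (hdg : ∀ a, dg a ≤ k) (s : B × B × B) :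
    IsTame (windowBump k dg s) :=
  (IsTame.coord (isTameOnCircle_digitBump (four_mul_two_digits_add_three_le hk hdg _ _)) 3).mul
    (IsTame.coord (isTameOnCircle_digitBump (four_mul_digit_add_three_le hk hdg _)) 2)

theorem two_digits_injective (hk : 1 ≤ k) (hinj : Function.Injective dg) (hdg : ∀ a, dg a ≤ k)
    {a a' b b' : B} (h : dg a * (10 * k) + dg a' = dg b * (10 * k) + dg b') : a = b ∧ a' = b' := by
  have hlt : ∀ a, dg a < 10 * k := fun a => by linarith [hdg a]
  have hdiv : ∀ a a', (dg a * (10 * k) + dg a') / (10 * k) = dg a := fun a a' => by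
    rw [Nat.add_div_of_dvd_right (dvd_mul_left _ _), Nat.mul_div_cancel _ (by omega),
      Nat.div_eq_of_lt (hlt a'), add_zero]
  have hab : dg a = dg b := by rw [← hdiv a a', h, hdiv]
  rw [hab] at h
  exact ⟨hinj hab, hinj (Nat.add_left_cancel h)⟩

theorem selects_windowBump (hk : 1 ≤ k) (hinj : Function.Injective dg) (hdg : ∀ a, dg a ≤ k)
    (t : ℝ) (c : Stream' B × Stream' B) :
    Selects (windowBump k dg) (window c) (streamPoint k dg t c) := by
  obtain ⟨X, Y⟩ := c
  have hval : ∀ s, windowBump k dg s (streamPoint k dg t (X, Y)) =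
      (if dg X.head * (10 * k) + dg X.tail.head = dg s.1 * (10 * k) + dg s.2.1 then 1 else 0) *
        if dg Y.head = dg s.2.2 then 1 else 0 := fun s => by
    have hone := four_mul_digit_add_three_le hk hdg
    have htwo := four_mul_two_digits_add_three_le hk hdg
    have hIcc := streamVal_mem_Icc hk hdg
    change digitBump _ _ (circlePt (streamVal k dg X)) *
      digitBump _ _ (circlePt (streamVal k dg Y)) = _
    rw [streamVal_eq_two hk hdg X, streamVal_eq hk hdg Y,
      digitBump_circlePt (htwo _ _) (htwo _ _) (hIcc _).1 (hIcc _).2,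
      digitBump_circlePt (hone _) (hone _) (hIcc _).1 (hIcc _).2]
  refine ⟨by simp [hval, window], ?_⟩
  rintro ⟨a, a', b⟩ hne
  rw [hval, mul_eq_zero, or_iff_not_imp_left]
  intro hleft
  obtain ⟨rfl, rfl⟩ := two_digits_injective hk hinj hdg (by simpa using hleft)
  exact if_neg fun hb => hne (congrArg (X.head, X.tail.head, ·) (hinj hb).symm)

theorem exists_diffeo_scale_history {β : ℕ} (hβ : 1 ≤ β) :
    ∃ F, IsComputableDiffeo F ∧ ∀ t ∈ Set.Icc (0 : ℝ) (1 / 4), ∀ c : Stream' B × Stream' B,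
      F (streamPoint k dg t c) = streamPoint k dg (t / β) c := by
  have hβ' : (1 : ℝ) ≤ β := by exact_mod_cast hβ
  obtain ⟨F, hF, h⟩ := exists_selected_affine (σ := Unit) (i := 0) (by decide)
    (S := fun _ _ => ((1 : ℚ) : ℝ)) (fun _ => IsTame.const 1) (fun _ _ _ => rfl)
    (fun _ _ _ => rfl) (fun _ => (β : ℚ)⁻¹) (fun _ => 0)
    fun _ => inv_ne_zero (Nat.cast_ne_zero.2 (Nat.one_le_iff_ne_zero.1 hβ))
  refine ⟨F, hF, fun t ht c => ?_⟩
  have hval : (((β : ℚ)⁻¹ : ℚ) : ℝ) * t + (0 : ℚ) = t / β := by push_cast; ring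
  rw [h (streamPoint k dg t c) () t ⟨Rat.cast_one, fun s hs => absurd rfl hs⟩ rfl rfl ht, hval]
  · rfl
  · rw [hval]
    exact ⟨div_nonneg ht.1 (by positivity), (div_le_self ht.1 hβ').trans ht.2⟩

theorem exists_diffeo_record_window [Finite B] (hk : 1 ≤ k) (hinj : Function.Injective dg)
    (hdg : ∀ a, dg a ≤ k) (v : B × B × B → ℚ) :
    ∃ F, IsComputableDiffeo F ∧ ∀ (t : ℝ) (c : Stream' B × Stream' B),
      F (streamPoint k dg t c) = streamPoint k dg (v (window c) + t) c := by
  have := Fintype.ofFinite B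
  refine ⟨_, isComputableDiffeo_shearMap 0 (IsTame.sum Finset.univ fun s _ =>
    (isTame_windowBump hk hdg s).mul (IsTame.const (v s))) fun w z => rfl, fun t c => ?_⟩
  rw [shearMap_eq rfl, (selects_windowBump hk hinj hdg t c).sum_mul]
  rfl

theorem exists_diffeo_replace_prefix {σ : Type*} [Finite σ] (hk : 1 ≤ k) (hdg : ∀ a, dg a ≤ k)
    {i : Fin 4} (hi0 : i ≠ 0) (hi1 : i ≠ 1) {num : σ → ℕ} (hnum : Function.Injective num) {β : ℕ}
    (hβ : ∀ s, 4 * num s + 3 ≤ 2 * β) (l l' : σ → List B) :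
    ∃ F, IsComputableDiffeo F ∧ ∀ z s (X : Stream' B), ∀ t ∈ Set.Icc (0 : ℝ) (1 / 4),
      coordAt 0 z = circlePt ((num s + t) / β) → coordAt 1 z = 1 →
      coordAt i z = circlePt (streamVal k dg (l s ++ₛ X)) →
      F z = setAt i (circlePt (streamVal k dg (l' s ++ₛ X))) z := by
  obtain ⟨F, hF, h⟩ := exists_selected_affine hi1
    (S := fun s z => digitBump β (num s) (coordAt 0 z))
    (fun s => IsTame.coord (isTameOnCircle_digitBump (hβ s)) 0)
    (fun s w z => by rw [coordAt_setAt_of_ne hi0.symm]) (fun s w z => rfl)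
    (fun s => prefixSlope k (l s) (l' s)) (fun s => prefixShift k dg (l s) (l' s))
    fun s => prefixSlope_ne_zero hk _ _
  refine ⟨F, hF, fun z s X t ht h0 h1 hX => ?_⟩
  have hsel : Selects (fun s z => digitBump β (num s) (coordAt 0 z)) s z := by
    refine ⟨?_, fun s' hs' => ?_⟩ <;> beta_reduce <;>
      rw [h0, digitBump_circlePt (hβ _) (hβ _) ht.1 ht.2]
    exacts [if_pos rfl, if_neg fun heq => hs' (hnum heq.symm)]
  rw [h z s _ hsel h1 hX (streamVal_mem_Icc hk hdg _), ← streamVal_replace hk hdg]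
  rw [← streamVal_replace hk hdg]
  exact streamVal_mem_Icc hk hdg _

theorem exists_diffeo_rewriteStep [Finite B] (hk : 1 ≤ k) (hinj : Function.Injective dg)
    (hdg : ∀ a, dg a ≤ k) (G : B → B → B → List B × List B) :
    ∃ F, IsComputableDiffeo F ∧ ∀ t ∈ Set.Icc (0 : ℝ) (1 / 8), ∀ c : Stream' B × Stream' B,
      ∃ t' ∈ Set.Icc (0 : ℝ) (1 / 8),
        F (streamPoint k dg t c) = streamPoint k dg t' (rewriteStep G c) := by
  set n := Nat.card (B × B × B)
  let num : B × B × B → ℕ := fun s => Finite.equivFin _ s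
  have hnum : Function.Injective num := Fin.val_injective.comp (Equiv.injective _)
  have hlt : ∀ s, num s < n := fun s => (Finite.equivFin (B × B × B) s).isLt
  have hβ : ∀ s, 4 * num s + 3 ≤ 2 * (8 * n + 8) := fun s => by linarith [hlt s]
  obtain ⟨F₁, hF₁, h₁⟩ := exists_diffeo_scale_history (B := B) (k := k) (dg := dg)
    (β := 8 * n + 8) (by omega)
  obtain ⟨F₂, hF₂, h₂⟩ := exists_diffeo_record_window hk hinj hdg fun s => num s / (8 * n + 8 : ℕ)
  obtain ⟨F₃, hF₃, h₃⟩ := exists_diffeo_replace_prefix hk hdg (i := 2) (by decide) (by decide) hnum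
    hβ (fun s => [s.2.2]) fun s => (G s.1 s.2.1 s.2.2).2
  obtain ⟨F₄, hF₄, h₄⟩ := exists_diffeo_replace_prefix hk hdg (i := 3) (by decide) (by decide) hnum
    hβ (fun s => [s.1, s.2.1]) fun s => (G s.1 s.2.1 s.2.2).1
  refine ⟨_, hF₄.comp (hF₃.comp (hF₂.comp hF₁)), fun t ht ⟨X, Y⟩ => ?_⟩
  have ht4 : t ∈ Set.Icc (0 : ℝ) (1 / 4) := ⟨ht.1, ht.2.trans (by norm_num)⟩
  set s := window (X, Y)
  have hX : streamVal k dg X = streamVal k dg ([s.1, s.2.1] ++ₛ X.tail.tail) := by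
    change _ = streamVal k dg ([X.head, X.tail.head] ++ₛ X.tail.tail)
    rw [Stream'.cons_append_stream, Stream'.append_eq_cons, Stream'.eta, Stream'.eta]
  have hY : streamVal k dg Y = streamVal k dg ([s.2.2] ++ₛ Y.tail) := by
    change _ = streamVal k dg ([Y.head] ++ₛ Y.tail)
    rw [Stream'.append_eq_cons, Stream'.eta]
  refine ⟨(num s + t) / (8 * n + 8 : ℕ), ⟨div_nonneg (add_nonneg (Nat.cast_nonneg _) ht.1)
    (Nat.cast_nonneg _), ?_⟩, ?_⟩
  · have hle : ((num s : ℕ) : ℝ) + 1 ≤ n := by exact_mod_cast hlt s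
    rw [div_le_iff₀ (by positivity)]
    push_cast
    linarith [ht.2]
  · have hhist : (((num s : ℚ) / (8 * n + 8 : ℕ) : ℚ) : ℝ) + t / (8 * n + 8 : ℕ) =
        (num s + t) / (8 * n + 8 : ℕ) := by push_cast; ring
    simp only [Function.comp_apply]
    rw [h₁ t ht4, h₂, hhist,
      h₃ (streamPoint k dg _ (X, Y)) s Y.tail t ht4 rfl rfl (congrArg circlePt hY)]
    exact h₄ (streamPoint k dg _ (X, (G _ _ _).2 ++ₛ Y.tail)) s X.tail.tail t ht4 rfl rfl
      (congrArg circlePt hX)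

end rewriteStep

/-! ### A universal prefix rewriting machine -/

/-- The actions in the table of a Turing machine: `jump` leads to another entry of the table,
`right`, `stay` and `left` move to a neighbouring block. -/
inductive Act
  | jump | right | stay | left | halt
  deriving DecidableEq

instance : Fintype Act := ⟨{.jump, .right, .stay, .left, .halt}, fun a => by cases a <;> simp⟩

/-- The letters of the words that encode the symbols of a Turing machine: a delimiter, the
beginnings of the rows and of the entries of the table, unary digits, and actions. The word of a
symbol is the table of the machine with the row of that symbol marked as active. -/
inductive Cell
  | delim | row (active : Bool) | comma | tick | act (a : Act)
  deriving DecidableEq, Fintype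

/-- A word `R` of rows, then a row whose entries `E` precede the entry `(m, a)`. -/
def tableWord (R E Z : List Cell) (b : Bool) (m : ℕ) (a : Act) : List Cell :=
  R ++ .row b :: (E ++ .comma :: (List.replicate m .tick ++ .act a :: Z))

/-- The phases of the universal machine: `find` the active row, `skip` entries until the counter
is zero, `read` an entry, go to the `next` block, go `back` to the row in order to toggle it, or
`home` to the delimiter, in the last two cases with the action to be performed afterwards. -/
inductive Phase
  | find | skip | read | next | back (a : Act) | home (a : Act)
  deriving DecidableEq, Fintype

/-- Letters of the tape: cells, the tally mark of the counter, and the states of the machine. The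
states `holdL p c` and `holdR p c` carry the cell `c` over the counter, which has to stay to the
left of the state in the phases `run p`, and `ret p` carries the counter back to the left. -/
inductive Letter
  | cell (c : Cell) | one | start | halt | run (p : Phase) | holdL (p : Phase) (c : Cell)
  | holdR (p : Phase) (c : Cell) | ret (p : Phase)
  deriving DecidableEq, Fintype

open Letter
open scoped Stream'

/-- The rewriting rule in the state `run p`. -/
def runRule (p : Phase) (x y : Letter) : List Letter × List Letter :=
  match p with
  | .find => match y with
    | cell (.row true) => ([holdL .skip (.row true), x], [])
    | cell c => ([holdL .find c, x], [])
    | _ => ([run p, x], [y])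
  | .skip => match y with
    | cell .comma => if x = one then ([holdL .skip .comma], []) else ([holdL .read .comma, x], [])
    | cell c => ([holdL .skip c, x], [])
    | _ => ([run p, x], [y])
  | .read => match y with
    | cell .tick => ([holdL .read .tick, x], [one])
    | cell (.act a) => ([run (if a = .halt then .home .halt else .back a), x], [y])
    | _ => ([run p, x], [y])
  | .next => match y with
    | cell .delim => ([holdL .find .delim, x], [])
    | cell c => ([holdL .next c, x], [])
    | _ => ([run p, x], [y])
  | .back a => match x with
    | one => ([run p], [x, y])
    | cell (.row b) => ([holdR (.home a) (.row !b)], [y])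
    | cell c => ([holdR (.back a) c], [y])
    | _ => ([run p, x], [y])
  | .home a => match x with
    | one => ([run p], [x, y])
    | cell .delim => match a with
      | .jump => ([ret .skip, x], [y])
      | .right => ([ret .next, x], [y])
      | .stay => ([ret .find, x], [y])
      | .left => ([holdR (.home .stay) .delim], [y])
      | .halt => ([Letter.halt], [y])
    | cell c => ([holdR (.home a) c], [y])
    | _ => ([run p, x], [y])

/-- The rewriting rule of the machine: `q` is the state, `x` the letter to the left of it and `y`
the letter to the right. -/
def rule (q x y : Letter) : List Letter × List Letter :=
  match q with
  | start => ([run .find, cell .delim, x], [y])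
  | holdL p c => if x = one then ([q], [x, y]) else ([ret p, cell c, x], [y])
  | holdR p c => if y = one then ([q, y, x], []) else ([run p, x], [cell c, y])
  | ret p => if y = one then ([q, y, x], []) else ([run p, x], [y])
  | run p => runRule p x y
  | _ => ([q, x], [y])

/-- A configuration of the machine: the state followed by the tape to the left of it, and the tape
to the right of it. -/
abbrev Config := Stream' Letter × Stream' Letter

/-- One step of the universal machine. -/
def machineStep : Config → Config := rewriteStep rule

theorem machineStep_cons (q x y : Letter) (X Y : Stream' Letter) :
    machineStep (q :: x :: X, y :: Y) = ((rule q x y).1 ++ₛ X, (rule q x y).2 ++ₛ Y) := rfl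

/-- Reachability by iterating the machine. -/
def Reach (c c' : Config) : Prop := ∃ n, machineStep^[n] c = c'

theorem Reach.refl (c : Config) : Reach c c := ⟨0, rfl⟩

theorem Reach.trans {c c' c'' : Config} (h : Reach c c') (h' : Reach c' c'') : Reach c c'' := by
  obtain ⟨n, rfl⟩ := h
  obtain ⟨m, rfl⟩ := h'
  exact ⟨m + n, Function.iterate_add_apply _ _ _ _⟩

theorem Reach.head {c c' : Config} (h : Reach (machineStep c) c') : Reach c c' := by
  obtain ⟨n, rfl⟩ := h
  exact ⟨n + 1, rfl⟩

/-- A stream of letters with a counter, that is, with `n` tally marks, in front. -/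
def tally (n : ℕ) (X : Stream' Letter) : Stream' Letter := List.replicate n one ++ₛ X

@[simp] theorem tally_zero (X : Stream' Letter) : tally 0 X = X := rfl

theorem tally_succ (n : ℕ) (X : Stream' Letter) : tally (n + 1) X = one :: tally n X := rfl

theorem tally_cons (n : ℕ) (X : Stream' Letter) : tally n (one :: X) = one :: tally n X := by
  induction n with
  | zero => rfl
  | succ n ih => rw [tally_succ, ih, ← tally_succ]

theorem tally_tally (n m : ℕ) (X : Stream' Letter) : tally n (tally m X) = tally (n + m) X := by
  rw [tally, tally, tally, ← Stream'.append_append_stream, List.replicate_append_replicate]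

theorem exists_eq_cons {α : Type*} (X : Stream' α) : ∃ (a : α) (Y : Stream' α), X = a :: Y :=
  ⟨X.head, X.tail, (Stream'.eta X).symm⟩

theorem reach_tally_right {q : Letter} (hq : ∀ y, rule q one y = ([q], [one, y])) (n : ℕ)
    (X Y : Stream' Letter) : Reach (q :: tally n X, Y) (q :: X, tally n Y) := by
  induction n generalizing Y with
  | zero => exact Reach.refl _
  | succ n ih =>
    obtain ⟨y, Y, rfl⟩ := exists_eq_cons Y
    refine Reach.head ?_
    rw [tally_succ, machineStep_cons, hq, tally_succ, ← tally_cons]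
    exact ih _

theorem reach_tally_left {q : Letter} (hq : ∀ x, rule q x one = ([q, one, x], [])) (n : ℕ)
    (X Y : Stream' Letter) : Reach (q :: X, tally n Y) (q :: tally n X, Y) := by
  induction n generalizing X with
  | zero => exact Reach.refl _
  | succ n ih =>
    obtain ⟨x, X, rfl⟩ := exists_eq_cons X
    refine Reach.head ?_
    rw [tally_succ, machineStep_cons, hq, tally_succ, ← tally_cons]
    exact ih _

/-- The configuration with the head in phase `p`, with counter `n`, between the cells `X` on the
left (read from right to left) and `Y` on the right. -/
def conf (p : Phase) (n : ℕ) (X Y : Stream' Cell) : Config :=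
  (run p :: tally n (X.map cell), Y.map cell)

theorem reach_ret (p : Phase) (n : ℕ) (X Y : Stream' Cell) :
    Reach (ret p :: X.map cell, tally n (Y.map cell)) (conf p n X Y) := by
  refine (reach_tally_left (fun _ => rfl) n _ _).trans (Reach.head ?_)
  obtain ⟨y, Y, rfl⟩ := exists_eq_cons Y
  obtain ⟨x, Z, hx⟩ := exists_eq_cons (tally n (X.map cell))
  rw [conf, hx, Stream'.map_cons, machineStep_cons]
  exact Reach.refl _

theorem reach_holdL (p : Phase) (c : Cell) (n : ℕ) (X Y : Stream' Cell) (m : ℕ) :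
    Reach (holdL p c :: tally n (X.map cell), tally m (Y.map cell))
      (conf p (n + m) (c :: X) Y) := by
  refine (reach_tally_right (fun _ => rfl) n _ _).trans (Reach.head ?_)
  rw [tally_tally]
  obtain ⟨x, X, rfl⟩ := exists_eq_cons X
  obtain ⟨y, Z, hy⟩ := exists_eq_cons (tally (n + m) (Y.map cell))
  have h := reach_ret p (n + m) (c :: x :: X) Y
  rw [hy, Stream'.map_cons, Stream'.map_cons] at h
  rw [hy, Stream'.map_cons, machineStep_cons]
  exact h

theorem reach_holdR (p : Phase) (c : Cell) (n : ℕ) (X Y : Stream' Cell) :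
    Reach (holdR p c :: X.map cell, tally n (Y.map cell)) (conf p n X (c :: Y)) := by
  refine (reach_tally_left (fun _ => rfl) n _ _).trans (Reach.head ?_)
  obtain ⟨y, Y, rfl⟩ := exists_eq_cons Y
  obtain ⟨x, Z, hx⟩ := exists_eq_cons (tally n (X.map cell))
  rw [conf, hx, Stream'.map_cons, machineStep_cons, Stream'.map_cons, Stream'.map_cons]
  simp only [rule, reduceCtorEq, if_false]
  exact Reach.refl _

theorem reach_step_right {p p' : Phase} {c : Cell} {m : ℕ}
    (h : ∀ x, rule (run p) x (cell c) = ([holdL p' c, x], List.replicate m one)) (n : ℕ)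
    (X Y : Stream' Cell) : Reach (conf p n X (c :: Y)) (conf p' (n + m) (c :: X) Y) := by
  refine Reach.head ?_
  obtain ⟨x, Z, hx⟩ := exists_eq_cons (tally n (X.map cell))
  have hhold := reach_holdL p' c n X Y m
  rw [hx] at hhold
  rw [conf, hx, Stream'.map_cons, machineStep_cons, h]
  exact hhold

theorem reach_step_left {p p' : Phase} {c c' : Cell}
    (hone : ∀ y, rule (run p) one y = ([run p], [one, y]))
    (h : ∀ y, rule (run p) (cell c) y = ([holdR p' c'], [y])) (n : ℕ) (X Y : Stream' Cell) :
    Reach (conf p n (c :: X) Y) (conf p' n X (c' :: Y)) := by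
  refine (reach_tally_right hone n _ _).trans (Reach.head ?_)
  obtain ⟨y, Z, hy⟩ := exists_eq_cons (tally n (Y.map cell))
  have hhold := reach_holdR p' c' n X Y
  rw [hy] at hhold
  rw [hy, Stream'.map_cons, machineStep_cons, h]
  exact hhold

theorem reach_turn {p p' : Phase} {c : Cell}
    (hone : ∀ y, rule (run p) one y = ([run p], [one, y]))
    (h : ∀ y, rule (run p) (cell c) y = ([ret p', cell c], [y])) (n : ℕ) (X Y : Stream' Cell) :
    Reach (conf p n (c :: X) Y) (conf p' n (c :: X) Y) := by
  refine (reach_tally_right hone n _ _).trans (Reach.head ?_)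
  obtain ⟨y, Z, hy⟩ := exists_eq_cons (tally n (Y.map cell))
  have hret := reach_ret p' n (c :: X) Y
  rw [hy, Stream'.map_cons] at hret
  rw [hy, Stream'.map_cons, machineStep_cons, h]
  exact hret

section Phases

variable (n : ℕ) (X Y : Stream' Cell)

theorem reach_find {c : Cell} (hc : c ≠ .row true) :
    Reach (conf .find n X (c :: Y)) (conf .find n (c :: X) Y) := by
  refine reach_step_right (m := 0) (fun x => ?_) n X Y
  rcases c with _ | (_ | _) | _ | _ | _
  case row.true => exact absurd rfl hc
  all_goals rfl

theorem reach_find_active :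
    Reach (conf .find n X (.row true :: Y)) (conf .skip n (.row true :: X) Y) :=
  reach_step_right (m := 0) (fun _ => rfl) n X Y

theorem reach_skip {c : Cell} (hc : c ≠ .comma) :
    Reach (conf .skip n X (c :: Y)) (conf .skip n (c :: X) Y) := by
  refine reach_step_right (m := 0) (fun x => ?_) n X Y
  cases c
  case comma => exact absurd rfl hc
  all_goals rfl

theorem reach_skip_comma :
    Reach (conf .skip (n + 1) X (.comma :: Y)) (conf .skip n (.comma :: X) Y) := by
  refine Reach.head ?_
  rw [conf, tally_succ, Stream'.map_cons, machineStep_cons]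
  exact reach_holdL .skip .comma n X Y 0

theorem reach_skip_zero :
    Reach (conf .skip 0 X (.comma :: Y)) (conf .read 0 (.comma :: X) Y) := by
  refine Reach.head ?_
  have h := reach_holdL .read .comma 0 X Y 0
  obtain ⟨x, X, rfl⟩ := exists_eq_cons X
  rw [tally_zero, Stream'.map_cons] at h
  rw [conf, tally_zero, Stream'.map_cons, Stream'.map_cons, machineStep_cons]
  exact h

theorem reach_read_tick :
    Reach (conf .read n X (.tick :: Y)) (conf .read (n + 1) (.tick :: X) Y) :=
  reach_step_right (fun _ => rfl) n X Y

theorem reach_read_act (a : Act) :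
    Reach (conf .read n X (.act a :: Y))
      (conf (if a = .halt then .home .halt else .back a) n X (.act a :: Y)) := by
  refine Reach.head ?_
  obtain ⟨x, Z, hx⟩ := exists_eq_cons (tally n (X.map cell))
  rw [conf, conf, hx, Stream'.map_cons, machineStep_cons]
  exact Reach.refl _

theorem reach_next {c : Cell} (hc : c ≠ .delim) :
    Reach (conf .next n X (c :: Y)) (conf .next n (c :: X) Y) := by
  refine reach_step_right (m := 0) (fun x => ?_) n X Y
  cases c
  case delim => exact absurd rfl hc
  all_goals rfl

theorem reach_next_delim : Reach (conf .next n X (.delim :: Y)) (conf .find n (.delim :: X) Y) :=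
  reach_step_right (m := 0) (fun _ => rfl) n X Y

theorem reach_back {a : Act} {c : Cell} (hc : ∀ b, c ≠ .row b) :
    Reach (conf (.back a) n (c :: X) Y) (conf (.back a) n X (c :: Y)) := by
  refine reach_step_left (fun _ => rfl) (fun y => ?_) n X Y
  cases c
  case row b => exact absurd rfl (hc b)
  all_goals rfl

theorem reach_back_row {a : Act} (b : Bool) :
    Reach (conf (.back a) n (.row b :: X) Y) (conf (.home a) n X (.row (!b) :: Y)) :=
  reach_step_left (fun _ => rfl) (fun _ => rfl) n X Y

theorem reach_home {a : Act} {c : Cell} (hc : c ≠ .delim) :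
    Reach (conf (.home a) n (c :: X) Y) (conf (.home a) n X (c :: Y)) := by
  refine reach_step_left (fun _ => rfl) (fun y => ?_) n X Y
  cases c
  case delim => exact absurd rfl hc
  all_goals rfl

theorem reach_home_jump :
    Reach (conf (.home .jump) n (.delim :: X) Y) (conf .skip n (.delim :: X) Y) :=
  reach_turn (fun _ => rfl) (fun _ => rfl) n X Y

theorem reach_home_right :
    Reach (conf (.home .right) n (.delim :: X) Y) (conf .next n (.delim :: X) Y) :=
  reach_turn (fun _ => rfl) (fun _ => rfl) n X Y

theorem reach_home_stay :
    Reach (conf (.home .stay) n (.delim :: X) Y) (conf .find n (.delim :: X) Y) :=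
  reach_turn (fun _ => rfl) (fun _ => rfl) n X Y

theorem reach_home_left :
    Reach (conf (.home .left) n (.delim :: X) Y) (conf (.home .stay) n X (.delim :: Y)) :=
  reach_step_left (fun _ => rfl) (fun _ => rfl) n X Y

theorem reach_home_halt :
    Reach (conf (.home .halt) 0 (.delim :: X) Y) (Letter.halt :: X.map cell, Y.map cell) := by
  refine Reach.head ?_
  obtain ⟨y, Y, rfl⟩ := exists_eq_cons Y
  rw [conf, tally_zero, Stream'.map_cons, Stream'.map_cons, machineStep_cons]
  exact Reach.refl _

end Phases

theorem reverse_append_cons {α : Type*} (w : List α) (c : α) (X : Stream' α) :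
    w.reverse ++ₛ (c :: X) = (c :: w).reverse ++ₛ X := by
  rw [List.reverse_cons, Stream'.append_append_stream, Stream'.append_eq_cons]

theorem reach_scan_right {p : Phase} {n : ℕ} {w : List Cell}
    (h : ∀ c ∈ w, ∀ X Y, Reach (conf p n X (c :: Y)) (conf p n (c :: X) Y)) (X Y : Stream' Cell) :
    Reach (conf p n X (w ++ₛ Y)) (conf p n (w.reverse ++ₛ X) Y) := by
  induction w generalizing X with
  | nil => exact Reach.refl _
  | cons c w ih =>
    rw [← reverse_append_cons]
    exact (h c List.mem_cons_self X (w ++ₛ Y)).trans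
      (ih (fun c hc => h c (List.mem_cons_of_mem _ hc)) _)

theorem reach_scan_left {p : Phase} {n : ℕ} {w : List Cell}
    (h : ∀ c ∈ w, ∀ X Y, Reach (conf p n (c :: X) Y) (conf p n X (c :: Y))) (X Y : Stream' Cell) :
    Reach (conf p n (w.reverse ++ₛ X) Y) (conf p n X (w ++ₛ Y)) := by
  induction w generalizing X with
  | nil => exact Reach.refl _
  | cons c w ih =>
    rw [← reverse_append_cons]
    exact (ih (fun c hc => h c (List.mem_cons_of_mem _ hc)) _).trans
      (h c List.mem_cons_self X (w ++ₛ Y))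

section Scans

variable {w : List Cell} (n : ℕ) (X Y : Stream' Cell)

theorem reach_find_list (hw : .row true ∉ w) :
    Reach (conf .find n X (w ++ₛ Y)) (conf .find n (w.reverse ++ₛ X) Y) :=
  reach_scan_right (fun _ hc X Y => reach_find n X Y (ne_of_mem_of_not_mem hc hw)) X Y

theorem reach_next_list (hw : .delim ∉ w) :
    Reach (conf .next n X (w ++ₛ Y)) (conf .next n (w.reverse ++ₛ X) Y) :=
  reach_scan_right (fun _ hc X Y => reach_next n X Y (ne_of_mem_of_not_mem hc hw)) X Y

theorem reach_back_list {a : Act} (hw : ∀ b, .row b ∉ w) :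
    Reach (conf (.back a) n (w.reverse ++ₛ X) Y) (conf (.back a) n X (w ++ₛ Y)) :=
  reach_scan_left (fun _ hc X Y => reach_back n X Y fun b => ne_of_mem_of_not_mem hc (hw b)) X Y

theorem reach_home_list {a : Act} (hw : .delim ∉ w) :
    Reach (conf (.home a) n (w.reverse ++ₛ X) Y) (conf (.home a) n X (w ++ₛ Y)) :=
  reach_scan_left (fun _ hc X Y => reach_home n X Y (ne_of_mem_of_not_mem hc hw)) X Y

theorem reach_skip_list (w : List Cell) :
    Reach (conf .skip (w.count .comma + n) X (w ++ₛ Y)) (conf .skip n (w.reverse ++ₛ X) Y) := by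
  induction w generalizing X with
  | nil => rw [List.count_nil, zero_add]; exact Reach.refl _
  | cons c w ih =>
    rw [← reverse_append_cons, Stream'.cons_append_stream]
    by_cases hc : c = .comma
    · subst hc
      rw [List.count_cons_self, add_right_comm]
      exact (reach_skip_comma _ _ _).trans (ih _)
    · rw [List.count_cons_of_ne hc]
      exact (reach_skip _ _ _ hc).trans (ih _)

theorem reach_read_ticks (m : ℕ) :
    Reach (conf .read n X (List.replicate m .tick ++ₛ Y))
      (conf .read (n + m) ((List.replicate m .tick).reverse ++ₛ X) Y) := by
  induction m generalizing n X with
  | zero => exact Reach.refl _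
  | succ m ih =>
    rw [List.replicate_succ, ← reverse_append_cons, Stream'.cons_append_stream, ← add_assoc,
      add_right_comm]
    exact (reach_read_tick _ _ _).trans (ih _ _)

end Scans

section TableWord

variable {R E Z : List Cell} {m : ℕ} {a : Act}

theorem tableWord_append (R E Z : List Cell) (b : Bool) (m : ℕ) (a : Act) (Y : Stream' Cell) :
    tableWord R E Z b m a ++ₛ Y = R ++ₛ (.row b :: (E ++ₛ (.comma ::
      (List.replicate m .tick ++ₛ (.act a :: (Z ++ₛ Y)))))) := by
  simp only [tableWord, Stream'.append_append_stream, Stream'.cons_append_stream]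

theorem reach_entry (hE : ∀ b, .row b ∉ E) (hR : .delim ∉ R) (ha : a ≠ .halt) (b : Bool)
    (X Y : Stream' Cell) :
    Reach (conf .skip (E.count .comma) (.row b :: (R.reverse ++ₛ X))
        (E ++ₛ (.comma :: (List.replicate m .tick ++ₛ (.act a :: (Z ++ₛ Y))))))
      (conf (.home a) m X (tableWord R E Z (!b) m a ++ₛ Y)) := by
  have hread := reach_read_act m
    ((List.replicate m .tick).reverse ++ₛ (.comma :: (E.reverse ++ₛ (.row b :: (R.reverse ++ₛ X)))))
    (Z ++ₛ Y) a
  rw [if_neg ha] at hread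
  have hticks := reach_read_ticks 0 (.comma :: (E.reverse ++ₛ (.row b :: (R.reverse ++ₛ X))))
    (.act a :: (Z ++ₛ Y)) m
  rw [zero_add] at hticks
  rw [tableWord_append]
  exact (reach_skip_list 0 _ _ E).trans <| (reach_skip_zero _ _).trans <| hticks.trans <|
    hread.trans <| (reach_back_list _ _ _ (by simp [List.mem_replicate])).trans <|
    (reach_back _ _ _ (by simp)).trans <| (reach_back_list _ _ _ hE).trans <|
    (reach_back_row _ _ _ b).trans <| reach_home_list _ _ _ hR

theorem reach_find_entry (hE : ∀ b, .row b ∉ E) (hR : .delim ∉ R) (hactive : .row true ∉ R)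
    (ha : a ≠ .halt) (X Y : Stream' Cell) :
    Reach (conf .find (E.count .comma) X (tableWord R E Z true m a ++ₛ Y))
      (conf (.home a) m X (tableWord R E Z false m a ++ₛ Y)) := by
  rw [tableWord_append]
  exact (reach_find_list _ _ _ hactive).trans <| (reach_find_active _ _ _).trans <|
    reach_entry hE hR ha true X Y

theorem reach_skip_entry (hE : ∀ b, .row b ∉ E) (hR : .delim ∉ R) (ha : a ≠ .halt)
    (X Y : Stream' Cell) :
    Reach (conf .skip (R.count .comma + E.count .comma) X (tableWord R E Z false m a ++ₛ Y))
      (conf (.home a) m X (tableWord R E Z true m a ++ₛ Y)) := by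
  rw [tableWord_append]
  exact (reach_skip_list _ _ _ R).trans <| (reach_skip _ _ _ (by simp)).trans <|
    reach_entry hE hR ha false X Y

theorem reach_find_halt (hE : .delim ∉ E) (hR : .delim ∉ R) (hactive : .row true ∉ R)
    (X Y : Stream' Cell) :
    Reach (conf .find (E.count .comma) (.delim :: X) (tableWord R E Z true 0 .halt ++ₛ Y))
      (Letter.halt :: X.map cell, (tableWord R E Z true 0 .halt ++ₛ Y).map cell) := by
  rw [tableWord_append]
  exact (reach_find_list _ _ _ hactive).trans <| (reach_find_active _ _ _).trans <|
    (reach_skip_list 0 _ _ E).trans <| (reach_skip_zero _ _).trans <|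
    (reach_read_act _ _ _ .halt).trans <| (reach_home _ _ _ (by simp)).trans <|
    (reach_home_list _ _ _ hE).trans <| (reach_home _ _ _ (by simp)).trans <|
    (reach_home_list _ _ _ hR).trans <| reach_home_halt _ _

end TableWord

/-! ### Words for the symbols of a Turing machine -/

theorem flatMap_range_split {α : Type*} (f : ℕ → List α) {j n : ℕ} (h : j < n) :
    (List.range n).flatMap f = (List.range j).flatMap f ++
      (f j ++ (List.range (n - (j + 1))).flatMap fun i => f (j + 1 + i)) := by
  obtain ⟨d, rfl⟩ := Nat.exists_eq_add_of_lt h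
  rw [add_right_comm, List.range_add, List.flatMap_append, List.range_succ, List.flatMap_append,
    List.append_assoc, List.flatMap_map, Nat.add_sub_cancel_left, List.flatMap_singleton]

theorem flatMap_range_congr {α : Type*} {f g : ℕ → List α} {n : ℕ} (h : ∀ i < n, f i = g i) :
    (List.range n).flatMap f = (List.range n).flatMap g :=
  List.flatMap_congr fun i hi => h i (List.mem_range.1 hi)

theorem count_flatMap_range {α : Type*} [BEq α] {f : ℕ → List α} {x : α} {d : ℕ}
    (h : ∀ i, (f i).count x = d) (n : ℕ) : ((List.range n).flatMap f).count x = n * d := by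
  induction n with
  | zero => rw [zero_mul, List.range_zero, List.flatMap_nil, List.count_nil]
  | succ n ih =>
    rw [List.range_succ, List.flatMap_append, List.count_append, ih, List.flatMap_singleton, h,
      Nat.succ_mul]

namespace TuringMachine.Code

/-- The number of states of the described machine. -/
abbrev numStates (c : Code) : ℕ := c.1

/-- The number of symbols of the described machine. -/
abbrev numSymbols (c : Code) : ℕ := c.2.1

/-- The number of the halting state of the described machine. -/
abbrev haltState (c : Code) : ℕ := c.2.2.2.1

/-- The state with number `v` in the tables: `0` is an alias of the initial state and the state
number `q` of the machine has number `q + 1`. -/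
def state (c : Code) (v : ℕ) : ℕ := if v = 0 then c.2.2.1 else v - 1

/-- The entry of the transition table for the state number `q` and the symbol number `a`. -/
def transition (c : Code) (q a : ℕ) : ℕ × ℕ × ℕ := (c.2.2.2.2.getD q []).getD a (0, 0, 0)

/-- The number of entries in a row of the table that the universal machine uses. -/
def numEntries (c : Code) : ℕ := 4 * c.numStates + 1

/-- The motion of the head that corresponds to the shift `e - 1` of the tape. -/
def motion (e : ℕ) : Act := if e = 0 then .right else if e = 1 then .stay else .left

/-- The number of the entry that performs `motion e` and then continues in the state `q`. -/
def motionIndex (c : Code) (q e : ℕ) : ℕ := c.numStates + 1 + (3 * q + e)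

/-- The entry number `v` in the row of the symbol `a`: a counter and an action. The first entries
correspond to the states of the machine and jump to one of the other entries, in the row of the
symbol to be written, whose action is the motion of the head. -/
def entry (c : Code) (a v : ℕ) : ℕ × Act :=
  if v ≤ c.numStates then
    if c.state v = c.haltState then (0, .halt)
    else ((c.transition (c.state v) a).2.1 * c.numEntries +
      c.motionIndex (c.transition (c.state v) a).1 (c.transition (c.state v) a).2.2, .jump)
  else ((v - (c.numStates + 1)) / 3 + 1, motion ((v - (c.numStates + 1)) % 3))

/-- An entry of the table as a word. -/
def entryWord (c : Code) (a v : ℕ) : List Cell :=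
  .comma :: (List.replicate (c.entry a v).1 .tick ++ [.act (c.entry a v).2])

/-- The row of the symbol `a` as a word. -/
def rowWord (c : Code) (a : ℕ) (b : Bool) : List Cell :=
  .row b :: (List.range c.numEntries).flatMap (c.entryWord a)

/-- The table of the machine with the row of the symbol `a` activated; no row is active if `a` is
not the number of a symbol. -/
def bodyWord (c : Code) (a : ℕ) : List Cell :=
  (List.range c.numSymbols).flatMap fun i => c.rowWord i (i == a)

/-- The word for the symbol `a`. -/
def blockWord (c : Code) (a : ℕ) : List Cell := .delim :: c.bodyWord a

/-- The length of the words for the symbols. -/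
def blockLength (c : Code) : ℕ := (c.blockWord 0).length

/-- The rows that precede the row of the symbol `a`, none of them active. -/
def rowsBefore (c : Code) (a : ℕ) : List Cell :=
  (List.range a).flatMap fun i => c.rowWord i false

/-- The entries that precede the entry number `v` in the row of the symbol `a`. -/
def entriesBefore (c : Code) (a v : ℕ) : List Cell :=
  (List.range v).flatMap (c.entryWord a)

/-- The part of the table that follows the entry number `v` in the row of the symbol `a`. -/
def wordAfter (c : Code) (a v : ℕ) : List Cell :=
  ((List.range (c.numEntries - (v + 1))).flatMap fun i => c.entryWord a (v + 1 + i)) ++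
    (List.range (c.numSymbols - (a + 1))).flatMap fun i => c.rowWord (a + 1 + i) false

variable (c : Code)

theorem blockLength_pos : 0 < c.blockLength := Nat.succ_pos _

theorem length_bodyWord (a a' : ℕ) : (c.bodyWord a).length = (c.bodyWord a').length := by
  simp only [bodyWord, List.length_flatMap, rowWord, List.length_cons]

theorem length_blockWord (a : ℕ) : (c.blockWord a).length = c.blockLength := by
  rw [blockLength, blockWord, blockWord, List.length_cons, List.length_cons, c.length_bodyWord a 0]

theorem entry_of_halt {v : ℕ} (hv : v ≤ c.numStates) (hh : c.state v = c.haltState) (a : ℕ) :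
    c.entry a v = (0, .halt) := by
  rw [entry, if_pos hv, if_pos hh]

theorem entry_of_transition {v q' a a' e : ℕ} (hv : v ≤ c.numStates)
    (hh : c.state v ≠ c.haltState) (ht : c.transition (c.state v) a = (q', a', e)) :
    c.entry a v = (a' * c.numEntries + c.motionIndex q' e, .jump) := by
  rw [entry, if_pos hv, if_neg hh, ht]

theorem entry_motionIndex {e : ℕ} (he : e ≤ 2) (a q : ℕ) :
    c.entry a (c.motionIndex q e) = (q + 1, motion e) := by
  have hgt : ¬c.motionIndex q e ≤ c.numStates := by rw [motionIndex]; omega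
  rw [entry, if_neg hgt, motionIndex, Nat.add_sub_cancel_left, Nat.mul_add_mod,
    Nat.mul_add_div three_pos, Nat.mod_eq_of_lt (by omega), Nat.div_eq_of_lt (by omega), add_zero]

theorem motionIndex_lt {q e : ℕ} (hq : q < c.numStates) (he : e ≤ 2) :
    c.motionIndex q e < c.numEntries := by
  rw [motionIndex, numEntries]
  omega

theorem motion_ne_halt (e : ℕ) : motion e ≠ .halt := by
  rw [motion]
  split_ifs <;> simp

theorem count_comma_entryWord (a v : ℕ) : (c.entryWord a v).count .comma = 1 := by
  simp [entryWord, List.count_append, List.count_replicate]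

theorem count_comma_rowWord (a : ℕ) (b : Bool) : (c.rowWord a b).count .comma = c.numEntries := by
  rw [rowWord, List.count_cons_of_ne (by simp), count_flatMap_range (c.count_comma_entryWord a),
    mul_one]

theorem count_comma_rowsBefore (a : ℕ) : (c.rowsBefore a).count .comma = a * c.numEntries :=
  count_flatMap_range (fun i => c.count_comma_rowWord i false) a

theorem count_comma_entriesBefore (a v : ℕ) : (c.entriesBefore a v).count .comma = v := by
  rw [entriesBefore, count_flatMap_range (c.count_comma_entryWord a), mul_one]

theorem delim_notMem_entryWord (a v : ℕ) : .delim ∉ c.entryWord a v := by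
  simp [entryWord, List.mem_replicate]

theorem row_notMem_entryWord (a v : ℕ) (b : Bool) : .row b ∉ c.entryWord a v := by
  simp [entryWord, List.mem_replicate]

theorem delim_notMem_rowWord (a : ℕ) (b : Bool) : .delim ∉ c.rowWord a b := by
  simp [rowWord, delim_notMem_entryWord]

theorem delim_notMem_bodyWord (a : ℕ) : .delim ∉ c.bodyWord a := by
  simp [bodyWord, delim_notMem_rowWord]

theorem delim_notMem_rowsBefore (a : ℕ) : .delim ∉ c.rowsBefore a := by
  simp [rowsBefore, delim_notMem_rowWord]

theorem row_true_notMem_rowsBefore (a : ℕ) : .row true ∉ c.rowsBefore a := by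
  simp [rowsBefore, rowWord, row_notMem_entryWord]

theorem delim_notMem_entriesBefore (a v : ℕ) : .delim ∉ c.entriesBefore a v := by
  simp [entriesBefore, delim_notMem_entryWord]

theorem row_notMem_entriesBefore (a v : ℕ) (b : Bool) : .row b ∉ c.entriesBefore a v := by
  simp [entriesBefore, row_notMem_entryWord]

theorem bodyWord_eq_tableWord {a v x : ℕ} (ha : a < c.numSymbols) (hv : v < c.numEntries)
    (hx : x = a ∨ x = c.numSymbols) :
    c.bodyWord x = tableWord (c.rowsBefore a) (c.entriesBefore a v) (c.wordAfter a v) (a == x)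
      (c.entry a v).1 (c.entry a v).2 := by
  have hbefore : (List.range a).flatMap (fun i => c.rowWord i (i == x)) = c.rowsBefore a :=
    flatMap_range_congr fun i hi => by rw [beq_eq_false_iff_ne.2 (by omega)]
  have hafter : ((List.range (c.numSymbols - (a + 1))).flatMap
      fun i => c.rowWord (a + 1 + i) (a + 1 + i == x)) =
        (List.range (c.numSymbols - (a + 1))).flatMap fun i => c.rowWord (a + 1 + i) false :=
    flatMap_range_congr fun i hi => by rw [beq_eq_false_iff_ne.2 (by omega)]
  rw [bodyWord, flatMap_range_split _ ha, hbefore, hafter, rowWord, flatMap_range_split _ hv,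
    tableWord, wordAfter, ← entriesBefore, entryWord]
  simp only [List.cons_append, List.append_assoc, List.nil_append]

theorem bodyWord_injOn : Set.InjOn c.bodyWord (Set.Iio c.numSymbols) := by
  intro a ha a' ha' h
  wlog hlt : a < a' generalizing a a'
  · rcases (not_lt.1 hlt).eq_or_lt with heq | hlt'
    · exact heq.symm
    · exact (this ha' ha h.symm hlt').symm
  rw [bodyWord, bodyWord, flatMap_range_split _ ha, flatMap_range_split _ ha,
    flatMap_range_congr (g := fun i => c.rowWord i (i == a')) (n := a) fun i hi => by
      rw [beq_eq_false_iff_ne.2 hi.ne, beq_eq_false_iff_ne.2 (hi.trans hlt).ne]] at h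
  have hrow := List.append_cancel_left h
  simp [rowWord, hlt.ne] at hrow

end TuringMachine.Code

/-! ### Simulation of one step of a Turing machine -/

/-- The concatenation of the words `w (τ 0), w (τ 1), …`, all of length `L`. -/
def blockStream (w : ℕ → List Cell) (L : ℕ) (τ : ℕ → ℕ) : Stream' Cell :=
  fun n => (w (τ (n / L))).getD (n % L) .delim

theorem blockStream_eq {w : ℕ → List Cell} {L : ℕ} (hw : ∀ a, (w a).length = L) (hL : 0 < L)
    (τ : ℕ → ℕ) : blockStream w L τ = w (τ 0) ++ₛ blockStream w L fun i => τ (i + 1) := by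
  ext n
  rcases Nat.lt_or_ge n L with h | h
  · rw [Stream'.get_append_left _ _ _ (by rwa [hw])]
    change (w (τ (n / L))).getD (n % L) .delim = _
    rw [Nat.div_eq_of_lt h, Nat.mod_eq_of_lt h, List.getD_eq_getElem]
  · obtain ⟨d, rfl⟩ := Nat.exists_eq_add_of_le h
    have hget := Stream'.get_append_right d (w (τ 0)) (blockStream w L fun i => τ (i + 1))
    rw [hw] at hget
    rw [hget]
    change (w (τ ((L + d) / L))).getD ((L + d) % L) .delim =
      (w (τ (d / L + 1))).getD (d % L) .delim
    rw [Nat.add_mod_left, Nat.add_div_left _ hL]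

namespace TuringMachine.Code

variable (c : Code)

/-- The cells to the left of block number `0`, read from right to left. -/
def lefts (σ : ℤ → ℕ) : Stream' Cell :=
  blockStream (fun a => (c.blockWord a).reverse) c.blockLength fun i => σ (-1 - i)

/-- The cells to the right of block number `0`. -/
def rights (σ : ℤ → ℕ) : Stream' Cell :=
  blockStream c.blockWord c.blockLength fun i => σ (i + 1)

theorem lefts_eq (σ : ℤ → ℕ) : c.lefts σ =
    (c.bodyWord (σ (-1))).reverse ++ₛ (.delim :: c.lefts fun i => σ (i - 1)) := by
  rw [lefts, blockStream_eq (fun a => by rw [List.length_reverse, c.length_blockWord])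
    c.blockLength_pos, reverse_append_cons, lefts]
  push_cast
  simp only [sub_add_eq_sub_sub_swap, sub_right_comm]
  rfl

theorem rights_eq (σ : ℤ → ℕ) :
    c.rights σ = .delim :: (c.bodyWord (σ 1) ++ₛ c.rights fun i => σ (i + 1)) := by
  rw [rights, blockStream_eq c.length_blockWord c.blockLength_pos, rights]
  push_cast
  rfl

theorem lefts_update_zero (σ : ℤ → ℕ) (a : ℕ) : c.lefts (Function.update σ 0 a) = c.lefts σ :=
  congrArg (blockStream _ _) <| funext fun _ => Function.update_of_ne (by omega) _ _

theorem rights_update_zero (σ : ℤ → ℕ) (a : ℕ) : c.rights (Function.update σ 0 a) = c.rights σ :=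
  congrArg (blockStream _ _) <| funext fun _ => Function.update_of_ne (by omega) _ _

/-- The machine is about to look up the entry `v` of the table, and the tape encodes `σ`. -/
def lookup (v : ℕ) (σ : ℤ → ℕ) : Config :=
  conf .find v (.delim :: c.lefts σ) (c.bodyWord (σ 0) ++ₛ c.rights σ)

/-- The configuration whose tape encodes `σ`, with the state `z` instead of the first letter of
block number `0`. -/
def withState (z : Letter) (σ : ℤ → ℕ) : Config :=
  (z :: (c.lefts σ).map Letter.cell, (c.bodyWord (σ 0) ++ₛ c.rights σ).map Letter.cell)

theorem reach_lookup_zero (σ : ℤ → ℕ) : Reach (c.withState .start σ) (c.lookup 0 σ) := by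
  refine Reach.head ?_
  rw [withState, lookup, conf, tally_zero, Stream'.map_cons]
  obtain ⟨x, X, hX⟩ := exists_eq_cons ((c.lefts σ).map Letter.cell)
  obtain ⟨y, Y, hY⟩ := exists_eq_cons ((c.bodyWord (σ 0) ++ₛ c.rights σ).map Letter.cell)
  rw [hX, hY, machineStep_cons]
  exact Reach.refl _

theorem reach_halt {v : ℕ} {σ : ℤ → ℕ} (hσ : σ 0 < c.numSymbols) (hv : v ≤ c.numStates)
    (hh : c.state v = c.haltState) : Reach (c.lookup v σ) (c.withState .halt σ) := by
  have hfind := reach_find_halt (Z := c.wordAfter (σ 0) v) (c.delim_notMem_entriesBefore (σ 0) v)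
    (c.delim_notMem_rowsBefore (σ 0)) (c.row_true_notMem_rowsBefore (σ 0)) (c.lefts σ) (c.rights σ)
  rw [count_comma_entriesBefore] at hfind
  have hlt : v < c.numEntries := by rw [numEntries]; omega
  rw [lookup, withState, c.bodyWord_eq_tableWord hσ hlt (.inl rfl), c.entry_of_halt hv hh,
    beq_self_eq_true]
  exact hfind

theorem reach_deactivate {v n : ℕ} {b : Act} {σ : ℤ → ℕ} (hσ : σ 0 < c.numSymbols)
    (hv : v < c.numEntries) (he : c.entry (σ 0) v = (n, b)) (hb : b ≠ .halt) :
    Reach (c.lookup v σ)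
      (conf (.home b) n (.delim :: c.lefts σ) (c.bodyWord c.numSymbols ++ₛ c.rights σ)) := by
  have hfind := reach_find_entry (m := n) (Z := c.wordAfter (σ 0) v)
    (c.row_notMem_entriesBefore (σ 0) v) (c.delim_notMem_rowsBefore (σ 0))
    (c.row_true_notMem_rowsBefore (σ 0)) hb (.delim :: c.lefts σ) (c.rights σ)
  rw [count_comma_entriesBefore] at hfind
  rw [lookup, c.bodyWord_eq_tableWord hσ hv (.inl rfl), c.bodyWord_eq_tableWord hσ hv (.inr rfl),
    he, beq_self_eq_true, beq_eq_false_iff_ne.2 hσ.ne]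
  exact hfind

theorem reach_activate {v n a : ℕ} {b : Act} (ha : a < c.numSymbols) (hv : v < c.numEntries)
    (he : c.entry a v = (n, b)) (hb : b ≠ .halt) (X Y : Stream' Cell) :
    Reach (conf (.home .jump) (a * c.numEntries + v) (.delim :: X) (c.bodyWord c.numSymbols ++ₛ Y))
      (conf (.home b) n (.delim :: X) (c.bodyWord a ++ₛ Y)) := by
  have hskip := reach_skip_entry (m := n) (Z := c.wordAfter a v) (c.row_notMem_entriesBefore a v)
    (c.delim_notMem_rowsBefore a) hb (.delim :: X) Y
  rw [count_comma_rowsBefore, count_comma_entriesBefore] at hskip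
  refine (reach_home_jump _ _ _).trans ?_
  rw [c.bodyWord_eq_tableWord ha hv (.inl rfl), c.bodyWord_eq_tableWord ha hv (.inr rfl), he,
    beq_self_eq_true, beq_eq_false_iff_ne.2 ha.ne]
  exact hskip

theorem reach_move_right (n : ℕ) (σ : ℤ → ℕ) :
    Reach (conf (.home .right) n (.delim :: c.lefts σ) (c.bodyWord (σ 0) ++ₛ c.rights σ))
      (c.lookup n fun i => σ (i + 1)) := by
  refine (reach_home_right _ _ _).trans
    ((reach_next_list _ _ _ (c.delim_notMem_bodyWord _)).trans ?_)
  rw [lookup, c.lefts_eq fun i => σ (i + 1), c.rights_eq σ]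
  simp only [neg_add_cancel, sub_add_cancel, zero_add]
  exact reach_next_delim _ _ _

theorem reach_move_left (n : ℕ) (σ : ℤ → ℕ) :
    Reach (conf (.home .left) n (.delim :: c.lefts σ) (c.bodyWord (σ 0) ++ₛ c.rights σ))
      (c.lookup n fun i => σ (i - 1)) := by
  refine (reach_home_left _ _ _).trans ?_
  rw [lookup, c.lefts_eq σ, c.rights_eq fun i => σ (i - 1)]
  simp only [sub_self, add_sub_cancel_right, zero_sub]
  exact (reach_home_list _ _ _ (c.delim_notMem_bodyWord _)).trans (reach_home_stay _ _ _)

theorem reach_motion {e : ℕ} (he : e ≤ 2) (n : ℕ) (σ : ℤ → ℕ) :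
    Reach (conf (.home (motion e)) n (.delim :: c.lefts σ) (c.bodyWord (σ 0) ++ₛ c.rights σ))
      (c.lookup n fun i => σ (i - ((e : ℤ) - 1))) := by
  interval_cases e
  · simpa [motion] using c.reach_move_right n σ
  · simpa [motion, lookup] using reach_home_stay n (c.lefts σ) (c.bodyWord (σ 0) ++ₛ c.rights σ)
  · simpa [motion] using c.reach_move_left n σ

theorem exists_lookup_step {v q' a' e : ℕ} {σ : ℤ → ℕ} (hσ : σ 0 < c.numSymbols)
    (hv : v ≤ c.numStates) (hh : c.state v ≠ c.haltState)
    (ht : c.transition (c.state v) (σ 0) = (q', a', e)) (hq' : q' < c.numStates)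
    (ha' : a' < c.numSymbols) (he : e ≤ 2) :
    ∃ n, machineStep^[n + 1] (c.lookup v σ) =
      c.lookup (q' + 1) fun i => Function.update σ 0 a' (i - ((e : ℤ) - 1)) := by
  obtain ⟨n, hn⟩ := c.reach_deactivate hσ (by rw [numEntries]; omega)
    (c.entry_of_transition hv hh ht) (by simp)
  have hmove := c.reach_motion he (q' + 1) (Function.update σ 0 a')
  rw [Function.update_self, lefts_update_zero, rights_update_zero] at hmove
  obtain ⟨m, hm⟩ := (c.reach_activate ha' (c.motionIndex_lt hq' he) (c.entry_motionIndex he a' q')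
    (motion_ne_halt e) _ _).trans hmove
  rcases n with _ | n
  · exact absurd (congrArg (fun d : Config => d.1.head) hn) (by simp [lookup, conf])
  · exact ⟨m + n, by rw [add_assoc, Function.iterate_add_apply, hn, hm]⟩

end TuringMachine.Code

/-! ### Computability of the block code -/

noncomputable instance : Primcodable Act := Primcodable.ofEquiv _ (Fintype.equivFin Act)

noncomputable instance : Primcodable Cell := Primcodable.ofEquiv _ (Fintype.equivFin Cell)

theorem primrec_list_replicate {α : Type*} [Primcodable α] (x : α) :
    Primrec fun n => List.replicate n x :=
  (Primrec.list_map Primrec.list_range (Primrec.const x).to₂).of_eq fun n => by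
    rw [List.map_const', List.length_range]

namespace TuringMachine.Code

open Primrec

theorem primrec_numSymbols : Primrec numSymbols := fst.comp snd

theorem primrec_haltState : Primrec haltState := fst.comp (snd.comp (snd.comp snd))

theorem primrec_numEntries : Primrec numEntries := succ.comp (nat_mul.comp (const 4) fst)

theorem primrec_state : Primrec₂ state :=
  Primrec.ite (Primrec.eq.comp snd (const 0)) (fst.comp (snd.comp (snd.comp fst)))
    (nat_sub.comp snd (const 1))

theorem primrec_motion : Primrec motion :=
  Primrec.ite (Primrec.eq.comp Primrec.id (const 0)) (const _)
    (Primrec.ite (Primrec.eq.comp Primrec.id (const 1)) (const _) (const _))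

variable {α : Type*} [Primcodable α] {f : α → Code} {g h : α → ℕ}

theorem primrec_transition (hf : Primrec f) (hg : Primrec g) (hh : Primrec h) :
    Primrec fun x => (f x).transition (g x) (h x) :=
  (list_getD (0, 0, 0)).comp ((list_getD []).comp
    (snd.comp (snd.comp (snd.comp (snd.comp hf)))) hg) hh

theorem primrec_motionIndex (hf : Primrec f) (hg : Primrec g) (hh : Primrec h) :
    Primrec fun x => (f x).motionIndex (g x) (h x) :=
  nat_add.comp (succ.comp (fst.comp hf)) (nat_add.comp (nat_mul.comp (const 3) hg) hh)

theorem primrec_entry (hf : Primrec f) (hg : Primrec g) (hh : Primrec h) :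
    Primrec fun x => (f x).entry (g x) (h x) := by
  have hstate : Primrec fun x => (f x).state (h x) := primrec_state.comp hf hh
  have htrans := primrec_transition hf hstate hg
  have hindex := primrec_motionIndex hf (fst.comp htrans) (snd.comp (snd.comp htrans))
  have hsub : Primrec fun x => h x - ((f x).numStates + 1) :=
    nat_sub.comp hh (succ.comp (fst.comp hf))
  have hjump : Primrec fun x => ((f x).transition ((f x).state (h x)) (g x)).2.1 *
      (f x).numEntries + (f x).motionIndex ((f x).transition ((f x).state (h x)) (g x)).1
        ((f x).transition ((f x).state (h x)) (g x)).2.2 :=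
    nat_add.comp (nat_mul.comp (fst.comp (snd.comp htrans)) (primrec_numEntries.comp hf)) hindex
  exact Primrec.ite (nat_le.comp hh (fst.comp hf))
    (Primrec.ite (Primrec.eq.comp hstate (primrec_haltState.comp hf)) (const _)
      (Primrec.pair hjump (const _)))
    (Primrec.pair (succ.comp (nat_div.comp hsub (const 3)))
      (primrec_motion.comp (nat_mod.comp hsub (const 3))))

theorem primrec_entryWord (hf : Primrec f) (hg : Primrec g) (hh : Primrec h) :
    Primrec fun x => (f x).entryWord (g x) (h x) := by
  have hentry := primrec_entry hf hg hh
  exact list_cons.comp (const _) (list_append.comp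
    ((primrec_list_replicate _).comp (fst.comp hentry))
    (list_cons.comp ((dom_finite Cell.act).comp (snd.comp hentry)) (const [])))

theorem primrec_rowWord {b : α → Bool} (hf : Primrec f) (hg : Primrec g) (hb : Primrec b) :
    Primrec fun x => (f x).rowWord (g x) (b x) :=
  list_cons.comp ((dom_finite Cell.row).comp hb)
    (list_flatMap (list_range.comp (primrec_numEntries.comp hf))
      (primrec_entryWord (hf.comp fst) (hg.comp fst) snd))

theorem primrec_bodyWord : Primrec₂ bodyWord :=
  list_flatMap (list_range.comp (primrec_numSymbols.comp fst))
    (primrec_rowWord (fst.comp fst) snd (Primrec.beq.comp snd (snd.comp fst)))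

theorem primrec_blockWord : Primrec₂ blockWord :=
  list_cons.comp (const _) primrec_bodyWord

theorem primrec_blockLength : Primrec blockLength :=
  list_length.comp (primrec_blockWord.comp Primrec.id (const 0))

end TuringMachine.Code

section BlockCode

open TuringMachine Primrec

/-- The letter number `r` in the word for the symbol `a`; if `o` is true, then the word stands in
position `0` of the tape and its first letter is the state `z`. -/
def blockLetter (z : Letter) (c : Code) (o : Bool) (a r : ℕ) : Letter :=
  if o = true ∧ r = 0 then z else .cell ((c.blockWord a).getD r .delim)

variable {k : ℕ} (φ : Letter ≃ Fin (k + 1))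

theorem primrec_blockLetter (z : Letter) :
    Primrec fun p : Code × Bool × ℕ × ℕ => φ (blockLetter z p.1 p.2.1 p.2.2.1 p.2.2.2) := by
  have hcell : Primrec fun p : Code × Bool × ℕ × ℕ =>
      φ (.cell ((p.1.blockWord p.2.2.1).getD p.2.2.2 .delim)) :=
    (dom_finite fun d => φ (.cell d)).comp <| (list_getD _).comp
      (Code.primrec_blockWord.comp fst (fst.comp (snd.comp snd))) (snd.comp (snd.comp snd))
  refine (Primrec.ite ((Primrec.eq.comp (fst.comp snd) (const true)).and
    (Primrec.eq.comp (snd.comp (snd.comp snd)) (const 0))) (const (φ z)) hcell).of_eq fun p => ?_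
  rw [blockLetter]
  split_ifs <;> rfl

/-- The number of the symbol whose word is `w`, if the first letter of `w` marks the beginning of a
block or a halted machine; otherwise, or if there is no such symbol, the number of symbols, which is
not the number of a symbol. -/
def readWord (c : Code) (w : List (Fin (k + 1))) : ℕ :=
  if w.head? = some (φ (.cell .delim)) ∨ w.head? = some (φ .halt) then
    (List.range c.numSymbols).findIdx fun a =>
      decide ((c.bodyWord a).map (fun d => φ (.cell d)) = w.tail)
  else c.numSymbols

theorem primrec_readWord : Primrec₂ (readWord φ) := by
  have hsymbols : Primrec fun p : Code × List (Fin (k + 1)) => p.1.numSymbols :=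
    Code.primrec_numSymbols.comp fst
  have hword : Primrec₂ fun (p : Code × List (Fin (k + 1))) (a : ℕ) =>
      (p.1.bodyWord a).map fun d => φ (.cell d) :=
    list_map (Code.primrec_bodyWord.comp (fst.comp fst) snd)
      ((dom_finite fun d => φ (.cell d)).comp snd).to₂
  exact Primrec.ite ((Primrec.eq.comp (list_head?.comp snd) (const _)).or
      (Primrec.eq.comp (list_head?.comp snd) (const _)))
    (list_findIdx (list_range.comp hsymbols)
      (Primrec.eq.comp hword (list_tail.comp (snd.comp fst))).decide)
    hsymbols

theorem readWord_eq {c : Code} {a : ℕ} (ha : a < c.numSymbols) {z : Letter}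
    (hz : z = .cell .delim ∨ z = .halt) :
    readWord φ c (φ z :: (c.bodyWord a).map fun d => φ (.cell d)) = a := by
  rw [readWord, if_pos (by rcases hz with rfl | rfl <;> simp),
    List.findIdx_eq (by rwa [List.length_range])]
  refine ⟨by simp, fun j hj => ?_⟩
  rw [decide_eq_false_iff_not, List.getElem_range, List.tail_cons]
  intro h
  have hinj : Function.Injective fun d => φ (.cell d) :=
    φ.injective.comp fun _ _ h => Letter.cell.inj h
  exact hj.ne (c.bodyWord_injOn (hj.trans ha) ha (List.map_injective_iff.2 hinj h))

theorem head_eq_of_readWord_lt {c : Code} {x : Fin (k + 1)} {w : List (Fin (k + 1))}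
    (h : readWord φ c (x :: w) < c.numSymbols) : x = φ (.cell .delim) ∨ x = φ .halt := by
  by_contra hx
  rw [readWord, if_neg (by simpa using hx)] at h
  exact h.false

/-- The block code of the universal machine, with its letters numbered by `φ`: the word for a symbol
is the table of the machine with the row of this symbol activated. -/
noncomputable def blockCoding : BlockCoding k where
  len := Code.blockLength
  digit p := φ (blockLetter .start p.1 p.2.1 p.2.2.1 p.2.2.2)
  read p := readWord φ p.1 p.2
  len_pos := Code.blockLength_pos
  computable_len := Code.primrec_blockLength.to_comp
  computable_digit := (primrec_blockLetter φ .start).to_comp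
  computable_read := (primrec_readWord φ).to_comp

end BlockCode

/-! ### Configurations as two-sided tapes -/

/-- The two-sided tape of a configuration: the left stream stands in the positions `0, -1, -2, …`
and the right stream in the positions `1, 2, …`. -/
def Config.tape (d : Config) (j : ℤ) : Letter :=
  if j ≤ 0 then d.1.get (-j).toNat else d.2.get (j - 1).toNat

theorem Config.tape_neg (d : Config) (n : ℕ) : d.tape (-n) = d.1.get n := by
  rw [Config.tape, if_pos (by omega), neg_neg, Int.toNat_natCast]

theorem Config.tape_add_one (d : Config) (n : ℕ) : d.tape (n + 1) = d.2.get n := by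
  rw [Config.tape, if_neg (by omega), add_sub_cancel_right, Int.toNat_natCast]

theorem neg_add_one_ediv_emod {L : ℕ} (hL : 0 < L) (n : ℕ) :
    -((n : ℤ) + 1) / L = -1 - (n / L : ℕ) ∧ -((n : ℤ) + 1) % L = (L - 1 - n % L : ℕ) := by
  have hlt := Nat.mod_lt n hL
  have hcast : ((L - 1 - n % L : ℕ) : ℤ) = L - 1 - (n % L : ℕ) := by omega
  have hn : (n : ℤ) = L * (n / L : ℕ) + (n % L : ℕ) := by exact_mod_cast (Nat.div_add_mod n L).symm
  refine (Int.ediv_emod_unique (by omega)).2 ⟨?_, by omega, by omega⟩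
  linear_combination hcast + hn

namespace TuringMachine.Code

variable (c : Code)

theorem delim_cons_rights (σ : ℤ → ℕ) : .delim :: (c.bodyWord (σ 0) ++ₛ c.rights σ) =
    blockStream c.blockWord c.blockLength fun i => σ i := by
  rw [blockStream_eq c.length_blockWord c.blockLength_pos, rights, blockWord]
  push_cast
  rfl

theorem tape_withState_neg (z : Letter) (σ : ℤ → ℕ) (n : ℕ) :
    (c.withState z σ).tape (-((n : ℤ) + 1)) =
      .cell ((c.blockWord (σ (-1 - (n / c.blockLength : ℕ)))).getD
        (c.blockLength - 1 - n % c.blockLength) .delim) := by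
  have hlt := Nat.mod_lt n c.blockLength_pos
  have hlen := c.length_blockWord (σ (-1 - (n / c.blockLength : ℕ)))
  rw [← Nat.cast_succ, Config.tape_neg]
  change Letter.cell ((c.blockWord (σ (-1 - (n / c.blockLength : ℕ)))).reverse.getD
    (n % c.blockLength) .delim) = _
  rw [List.getD_eq_getElem _ _ (by rwa [List.length_reverse, hlen]),
    List.getD_eq_getElem _ _ (by omega), List.getElem_reverse]
  simp only [hlen]

theorem tape_withState_pos (z : Letter) (σ : ℤ → ℕ) (n : ℕ) :
    (c.withState z σ).tape (n + 1) =
      .cell ((c.blockWord (σ ((n + 1) / c.blockLength : ℕ))).getD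
        ((n + 1) % c.blockLength) .delim) := by
  rw [Config.tape_add_one]
  exact congrArg (fun X => Letter.cell (X.get (n + 1))) (c.delim_cons_rights σ)

theorem tape_withState (z : Letter) (σ : ℤ → ℕ) (j : ℤ) :
    (c.withState z σ).tape j = blockLetter z c (decide (j / (c.blockLength : ℤ) = 0))
      (σ (j / (c.blockLength : ℤ))) (j % (c.blockLength : ℤ)).toNat := by
  rcases lt_trichotomy j 0 with hj | rfl | hj
  · obtain ⟨n, rfl⟩ : ∃ n : ℕ, j = -((n : ℤ) + 1) := ⟨(-j - 1).toNat, by omega⟩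
    obtain ⟨hdiv, hmod⟩ := neg_add_one_ediv_emod c.blockLength_pos n
    rw [tape_withState_neg, hdiv, hmod, blockLetter, if_neg, Int.toNat_natCast]
    rintro ⟨hzero, -⟩
    have hquot := Int.natCast_nonneg (n / c.blockLength)
    exact absurd (of_decide_eq_true hzero) (by omega)
  · rw [Int.zero_ediv, Int.zero_emod, blockLetter, if_pos (by simp)]
    rfl
  · obtain ⟨n, rfl⟩ : ∃ n : ℕ, j = (n : ℤ) + 1 := ⟨(j - 1).toNat, by omega⟩
    rw [tape_withState_pos, blockLetter, if_neg, ← Nat.cast_succ, ← Int.natCast_div,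
      ← Int.natCast_mod, Int.toNat_natCast]
    rintro ⟨hdiv, hmod⟩
    have hdvd : (c.blockLength : ℤ) ∣ n + 1 := Int.dvd_of_emod_eq_zero <|
      (Int.toNat_eq_zero.1 hmod).antisymm
        (Int.emod_nonneg _ (Int.natCast_ne_zero.2 c.blockLength_pos.ne'))
    have hprod := Int.ediv_mul_cancel hdvd
    rw [of_decide_eq_true hdiv] at hprod
    omega

theorem tapeBlock_withState (z : Letter) (σ : ℤ → ℕ) (i : ℤ) :
    tapeBlock c.blockLength (c.withState z σ).tape i =
      (if i = 0 then z else .cell .delim) :: (c.bodyWord (σ i)).map Letter.cell := by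
  have hlen := c.length_blockWord (σ i)
  have hletter (r : ℕ) (hr : r < c.blockLength) :
      (c.withState z σ).tape (c.blockLength * i + r) =
        blockLetter z c (decide (i = 0)) (σ i) r := by
    rw [tape_withState, Int.mul_add_ediv_left _ _ (by omega),
      Int.ediv_eq_zero_of_lt (by omega) (by omega), add_zero, Int.mul_add_emod_self_left,
      Int.emod_eq_of_lt (by omega) (by omega), Int.toNat_natCast]
  apply List.ext_getElem
  · rw [tapeBlock, List.length_ofFn, List.length_cons, List.length_map, ← hlen, blockWord,
      List.length_cons]
  · intro r hr _
    rw [tapeBlock, List.length_ofFn] at hr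
    simp only [tapeBlock, List.getElem_ofFn]
    rw [hletter r hr]
    rcases r with _ | r
    · by_cases hi : i = 0 <;> simp [blockLetter, hi, blockWord]
    · rw [blockLetter, if_neg (by simp), List.getD_eq_getElem _ _ (by rwa [hlen])]
      simp [blockWord]

end TuringMachine.Code

theorem map_tapeBlock {α β : Type*} (f : α → β) (L : ℕ) (u : ℤ → α) (i : ℤ) :
    tapeBlock L (fun j => f (u j)) i = (tapeBlock L u i).map f := by
  rw [tapeBlock, tapeBlock, List.map_ofFn]
  rfl

/-! ### The symbolic simulation -/

/-- The letters that stand for states of the rewriting machine. -/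
def Letter.IsState : Letter → Prop
  | .cell _ => False
  | .one => False
  | _ => True

theorem rule_isState {q : Letter} (hq : q.IsState) (x y : Letter) :
    ∃ (q' : Letter) (w : List Letter), (rule q x y).1 = q' :: w ∧ q'.IsState := by
  rcases q with c | _ | _ | _ | p | ⟨p, c⟩ | ⟨p, c⟩ | p
  · exact hq.elim
  · exact hq.elim
  · exact ⟨_, _, rfl, trivial⟩
  · exact ⟨_, _, rfl, trivial⟩
  · cases p <;> simp only [rule, runRule] <;> repeat' split
    all_goals exact ⟨_, _, rfl, trivial⟩
  all_goals
    simp only [rule]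
    split <;> exact ⟨_, _, rfl, trivial⟩

theorem isState_machineStep {d : Config} (h : d.1.head.IsState) :
    (machineStep d).1.head.IsState := by
  obtain ⟨q', w, hw, hq⟩ := rule_isState h d.1.tail.head d.2.head
  change ((rule d.1.head d.1.tail.head d.2.head).1 ++ₛ d.1.tail.tail).head.IsState
  rw [hw]
  exact hq

theorem isState_iterate {d : Config} (h : d.1.head.IsState) (n : ℕ) :
    (machineStep^[n] d).1.head.IsState :=
  Function.Iterate.rec (fun d : Config => d.1.head.IsState) h (fun _ => isState_machineStep) n

theorem machineStep_of_halt {d : Config} (h : d.1.head = .halt) : machineStep d = d := by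
  obtain ⟨X, Y⟩ := d
  obtain ⟨q, X, rfl⟩ := exists_eq_cons X
  obtain ⟨x, X, rfl⟩ := exists_eq_cons X
  obtain ⟨y, Y, rfl⟩ := exists_eq_cons Y
  obtain rfl : q = .halt := h
  rfl

theorem iterate_of_halt {d : Config} {j n : ℕ} (h : (machineStep^[j] d).1.head = .halt)
    (hn : j ≤ n) : machineStep^[n] d = machineStep^[j] d := by
  obtain ⟨i, rfl⟩ := Nat.exists_eq_add_of_le' hn
  rw [Function.iterate_add_apply]
  exact Function.iterate_fixed (machineStep_of_halt h) i

theorem exists_add_of_halt {d : Config} {j n : ℕ} (h : (machineStep^[j] d).1.head = .halt)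
    (hn : (machineStep^[n] d).1.head ≠ .halt) :
    ∃ i, j = i + n ∧ machineStep^[j] d = machineStep^[i] (machineStep^[n] d) := by
  rcases Nat.lt_or_ge n j with hlt | hle
  · obtain ⟨i, rfl⟩ := Nat.exists_eq_add_of_le' hlt.le
    exact ⟨i, rfl, Function.iterate_add_apply _ _ _ _⟩
  · exact absurd (iterate_of_halt h hle ▸ h) hn

theorem Reach.eq_of_halt {d e : Config} (hr : Reach d e) (he : e.1.head = .halt) {j : ℕ}
    (h : (machineStep^[j] d).1.head = .halt) : machineStep^[j] d = e := by
  obtain ⟨n, rfl⟩ := hr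
  rcases le_total j n with hle | hle
  · exact (iterate_of_halt h hle).symm
  · exact iterate_of_halt he hle

theorem getD_ofFn {α : Type*} {n : ℕ} (f : Fin n → α) (i : Fin n) (d : α) :
    (List.ofFn f).getD i d = f i := by
  rw [List.getD_eq_getElem _ _ (by rw [List.length_ofFn]; exact i.isLt), List.getElem_ofFn]

theorem toNat_sign_add_one_le (ε : SignType) : ((ε : ℤ) + 1).toNat ≤ 2 := by
  cases ε <;> decide

theorem toNat_sign_add_one_sub_one (ε : SignType) : (((ε : ℤ) + 1).toNat : ℤ) - 1 = ε := by
  cases ε <;> decide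

namespace TuringMachine

variable {Q A : Type*} {m l : ℕ} (T : TuringMachine Q A) (eQ : Q ≃ Fin m) (eA : A ≃ Fin l)

theorem transition_code {q : Q} (hq : q ≠ T.halt) (a : A) :
    (T.code eQ eA).transition (eQ q) (eA a) =
      ((eQ (T.δ ⟨q, hq⟩ a).1 : ℕ), (eA (T.δ ⟨q, hq⟩ a).2.1 : ℕ),
        (((T.δ ⟨q, hq⟩ a).2.2 : ℤ) + 1).toNat) := by
  simp only [Code.transition, code]
  rw [getD_ofFn, getD_ofFn]
  simp [hq]

theorem exists_lookup_next {q : Q} (hq : q ≠ T.halt) {s : ℤ → A} {v : ℕ} (hv : v ≤ m)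
    (hs : (T.code eQ eA).state v = eQ q) :
    ∃ n, machineStep^[n + 1] ((T.code eQ eA).lookup v fun i => eA (s i)) =
      (T.code eQ eA).lookup (eQ (T.next (q, s)).1 + 1) fun i => eA ((T.next (q, s)).2 i) := by
  have hhalt : (T.code eQ eA).state v ≠ (T.code eQ eA).haltState := by
    rw [hs]
    exact fun h => hq (eQ.injective (Fin.ext h))
  have htrans := T.transition_code eQ eA hq (s 0)
  rw [← hs] at htrans
  obtain ⟨n, hn⟩ := (T.code eQ eA).exists_lookup_step (σ := fun i => eA (s i)) (eA (s 0)).isLt hv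
    hhalt htrans (Fin.isLt _) (Fin.isLt _) (toNat_sign_add_one_le _)
  refine ⟨n, hn.trans ?_⟩
  rw [next, dif_neg hq]
  congr 1
  funext i
  rw [toNat_sign_add_one_sub_one]
  simp only [Function.update_apply]
  split_ifs <;> rfl

theorem state_code_succ (q : Q) : (T.code eQ eA).state (eQ q + 1) = eQ q := by
  rw [Code.state, if_neg (Nat.succ_ne_zero _), Nat.add_sub_cancel]

theorem state_code_zero : (T.code eQ eA).state 0 = eQ T.start := rfl

theorem reach_of_iterate_next {N v : ℕ} {q : Q} {s t : ℤ → A}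
    (h : T.next^[N] (q, s) = (T.halt, t)) (hv : v ≤ m)
    (hs : (T.code eQ eA).state v = eQ q) :
    Reach ((T.code eQ eA).lookup v fun i => eA (s i))
      ((T.code eQ eA).withState .halt fun i => eA (t i)) := by
  induction N generalizing q s v with
  | zero =>
    obtain ⟨rfl, rfl⟩ : q = T.halt ∧ s = t := Prod.ext_iff.1 h
    exact (T.code eQ eA).reach_halt (eA _).isLt hv hs
  | succ N ih =>
    rw [Function.iterate_succ_apply] at h
    by_cases hq : q = T.halt
    · subst hq
      rw [next, dif_pos rfl] at h
      exact ih h hv hs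
    · exact Reach.trans ((T.exists_lookup_next eQ eA hq hv hs).imp' _ fun _ => id)
        (ih h (Fin.isLt _) (T.state_code_succ eQ eA _))

theorem exists_halt_of_head {j v : ℕ} {q : Q} {s : ℤ → A} (hv : v ≤ m)
    (hs : (T.code eQ eA).state v = eQ q)
    (h : (machineStep^[j] ((T.code eQ eA).lookup v fun i => eA (s i))).1.head = .halt) :
    ∃ t, (∃ N, T.next^[N] (q, s) = (T.halt, t)) ∧
      machineStep^[j] ((T.code eQ eA).lookup v fun i => eA (s i)) =
        (T.code eQ eA).withState .halt fun i => eA (t i) := by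
  induction j using Nat.strong_induction_on generalizing q s v with
  | _ j ih =>
    by_cases hq : q = T.halt
    · subst hq
      exact ⟨s, ⟨0, rfl⟩, (T.reach_of_iterate_next eQ eA (N := 0) rfl hv hs).eq_of_halt rfl h⟩
    · obtain ⟨n, hn⟩ := T.exists_lookup_next eQ eA hq hv hs (s := s)
      obtain ⟨i, rfl, hi⟩ := exists_add_of_halt h (n := n + 1)
        (by rw [hn]; simp [Code.lookup, conf])
      rw [hi, hn] at h ⊢
      obtain ⟨t, ⟨N, hN⟩, ht⟩ := ih i (by omega) (q := (T.next (q, s)).1) (Fin.isLt _)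
        (T.state_code_succ eQ eA _) h
      exact ⟨t, ⟨N + 1, hN⟩, ht⟩

theorem HaltsWithTape.reach {T : TuringMachine Q A} {s t : ℤ → A} (h : T.HaltsWithTape s t) :
    Reach ((T.code eQ eA).withState .start fun i => eA (s i))
      ((T.code eQ eA).withState .halt fun i => eA (t i)) :=
  have ⟨_, hN⟩ := h
  ((T.code eQ eA).reach_lookup_zero _).trans
    (T.reach_of_iterate_next eQ eA hN (Nat.zero_le _) (T.state_code_zero eQ eA))

theorem exists_haltsWithTape {j : ℕ} {s : ℤ → A}
    (h : (machineStep^[j] ((T.code eQ eA).withState .start fun i => eA (s i))).1.head = .halt) :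
    ∃ t, T.HaltsWithTape s t ∧
      machineStep^[j] ((T.code eQ eA).withState .start fun i => eA (s i)) =
        (T.code eQ eA).withState .halt fun i => eA (t i) := by
  obtain ⟨n, hn⟩ := (T.code eQ eA).reach_lookup_zero fun i => eA (s i)
  obtain ⟨i, -, hi⟩ := exists_add_of_halt h (n := n) (by rw [hn]; simp [Code.lookup, conf])
  rw [hi, hn] at h ⊢
  exact T.exists_halt_of_head eQ eA (Nat.zero_le _) (T.state_code_zero eQ eA) h

end TuringMachine

/-! ### Distances in the Cantor set -/

theorem dist_circlePt (s t : ℝ) :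
    dist (circlePt s) (circlePt t) = 2 * |Real.sin (Real.pi * (s - t))| := by
  have hmul : circlePt s = circlePt (s - t) * circlePt t := by rw [← circlePt_add, sub_add_cancel]
  have hcoe : dist (circlePt s) (circlePt t) = dist (circlePt s : ℂ) (circlePt t) := rfl
  rw [hcoe, hmul, dist_eq_norm, Circle.coe_mul, ← sub_one_mul, norm_mul, Circle.norm_coe, mul_one,
    circlePt, Circle.coe_exp, mul_comm _ Complex.I, Complex.norm_exp_I_mul_ofReal_sub_one,
    norm_mul, Real.norm_eq_abs, Real.norm_eq_abs, abs_two, mul_assoc,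
    mul_div_cancel_left₀ _ two_ne_zero]

theorem four_mul_abs_sub_le_dist_circlePt {s t : ℝ} (h : |s - t| ≤ 1 / 2) :
    4 * |s - t| ≤ dist (circlePt s) (circlePt t) := by
  have habs : |Real.pi * (s - t)| = Real.pi * |s - t| := by rw [abs_mul, abs_of_pos Real.pi_pos]
  have hsin : 2 / Real.pi * |Real.pi * (s - t)| ≤ |Real.sin (Real.pi * (s - t))| :=
    Real.mul_abs_le_abs_sin (by rw [habs]; nlinarith [Real.pi_pos])
  rw [habs, ← mul_assoc, div_mul_cancel₀ _ Real.pi_ne_zero] at hsin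
  rw [dist_circlePt]
  linarith

theorem dist_circlePt_one_lt_one {t : ℝ} (ht : t ∈ Set.Icc (0 : ℝ) (1 / 8)) :
    dist (circlePt t) 1 < 1 := by
  have hsin := Real.abs_sin_le_abs (x := Real.pi * t)
  rw [abs_of_nonneg (mul_nonneg Real.pi_pos.le ht.1)] at hsin
  rw [← circlePt_zero, dist_circlePt, sub_zero]
  nlinarith [Real.pi_lt_four, Real.pi_pos, ht.2]

section streamVal

variable {B : Type*} {k : ℕ} {dg : B → ℕ}

theorem abs_streamVal_sub_le (hk : 1 ≤ k) (hdg : ∀ a, dg a ≤ k) (X Y : Stream' B) :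
    |streamVal k dg X - streamVal k dg Y| ≤ 1 / 4 := by
  have hX := streamVal_mem_Icc hk hdg X
  have hY := streamVal_mem_Icc hk hdg Y
  exact abs_le.2 ⟨by linarith [hX.1, hY.2], by linarith [hX.2, hY.1]⟩

theorem eq_of_abs_add_streamVal_sub_lt (hk : 1 ≤ k) (hdg : ∀ a, dg a ≤ k) {m n : ℕ}
    {X Y : Stream' B} (h : |(m + streamVal k dg X) - (n + streamVal k dg Y)| < 1 / 4) : m = n := by
  have htails := abs_le.1 (abs_streamVal_sub_le hk hdg X Y)
  have hsums := abs_lt.1 h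
  have hlt : |((m : ℤ) - n : ℤ)| < 1 := by
    have hreal : |(m : ℝ) - n| < 1 := abs_lt.2 ⟨by linarith, by linarith⟩
    exact_mod_cast hreal
  have hzero := Int.abs_lt_one_iff.1 hlt
  omega

theorem get_eq_of_abs_streamVal_sub_lt (hk : 1 ≤ k) (hinj : Function.Injective dg)
    (hdg : ∀ a, dg a ≤ k) {N : ℕ} {X Y : Stream' B}
    (h : 4 * |streamVal k dg X - streamVal k dg Y| < ((10 * (k : ℝ)) ^ N)⁻¹) {i : ℕ}
    (hi : i < N) : X.get i = Y.get i := by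
  have hk' : (1 : ℝ) ≤ k := by exact_mod_cast hk
  have hb : (0 : ℝ) < 10 * k := by positivity
  induction N generalizing X Y i with
  | zero => exact absurd hi i.not_lt_zero
  | succ N ih =>
    rw [streamVal_eq hk hdg X, streamVal_eq hk hdg Y, ← sub_div, abs_div, Nat.cast_mul,
      Nat.cast_ofNat, abs_of_pos hb, pow_succ, mul_inv, ← div_eq_mul_inv, ← mul_div_assoc,
      div_lt_div_iff_of_pos_right hb] at h
    have hone : ((10 * (k : ℝ)) ^ N)⁻¹ ≤ 1 := inv_le_one_of_one_le₀ (one_le_pow₀ (by linarith))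
    have hhead : dg X.head = dg Y.head :=
      eq_of_abs_add_streamVal_sub_lt hk hdg (X := X.tail) (Y := Y.tail) (by linarith)
    rcases i with _ | i
    · exact hinj hhead
    · rw [hhead, add_sub_add_left_eq_sub] at h
      exact ih h (Nat.lt_of_succ_lt_succ hi)

theorem get_eq_of_dist_circlePt_lt (hk : 1 ≤ k) (hinj : Function.Injective dg)
    (hdg : ∀ a, dg a ≤ k) {N : ℕ} {X Y : Stream' B}
    (h : dist (circlePt (streamVal k dg X)) (circlePt (streamVal k dg Y)) <
      ((10 * (k : ℝ)) ^ N)⁻¹) {i : ℕ} (hi : i < N) : X.get i = Y.get i :=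
  get_eq_of_abs_streamVal_sub_lt hk hinj hdg ((four_mul_abs_sub_le_dist_circlePt
    ((abs_streamVal_sub_le hk hdg X Y).trans (by norm_num))).trans_lt h) hi

end streamVal

theorem cantorPoint_eq (k : ℕ) (u : ℤ → Fin (k + 1)) : cantorPoint k u =
    (circlePt (streamVal k (fun d : Fin (k + 1) => (d : ℕ)) fun n => u (n + 1)),
      circlePt (streamVal k (fun d : Fin (k + 1) => (d : ℕ)) fun n => u (-n))) := rfl

theorem eq_of_dist_cantorPoint_lt {k : ℕ} (hk : 1 ≤ k) {u v : ℤ → Fin (k + 1)} {N : ℕ}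
    (h : dist (cantorPoint k u) (cantorPoint k v) < ((10 * (k : ℝ)) ^ N)⁻¹) {i : ℤ}
    (hi : -(N : ℤ) < i) (hi' : i ≤ N) : u i = v i := by
  rw [cantorPoint_eq, cantorPoint_eq, Prod.dist_eq, max_lt_iff] at h
  rcases le_or_gt i 0 with hneg | hpos
  · obtain ⟨n, rfl⟩ := Int.exists_eq_neg_ofNat hneg
    exact get_eq_of_dist_circlePt_lt hk Fin.val_injective Fin.is_le h.2 (by omega)
  · obtain ⟨n, rfl⟩ : ∃ n : ℕ, i = (n : ℤ) + 1 := ⟨(i - 1).toNat, by omega⟩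
    exact get_eq_of_dist_circlePt_lt hk Fin.val_injective Fin.is_le h.1 (by omega)

theorem tapeBlock_congr {B : Type*} {L : ℕ} {u v : ℤ → B} {i : ℤ}
    (h : ∀ j : ℤ, L * i ≤ j → j < L * i + L → u j = v j) : tapeBlock L u i = tapeBlock L v i :=
  congrArg List.ofFn <| funext fun r => h _ (by omega) (by omega)

theorem tapeBlock_eq_of_dist_cantorPoint_lt {k : ℕ} (hk : 1 ≤ k) {u v : ℤ → Fin (k + 1)}
    {L n : ℕ} (hL : 0 < L)
    (h : dist (cantorPoint k u) (cantorPoint k v) < ((10 * (k : ℝ)) ^ ((n + 1) * L))⁻¹)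
    (i : Set.Icc (-(n : ℤ)) (n : ℤ)) : tapeBlock L u i = tapeBlock L v i := by
  obtain ⟨i, hi, hi'⟩ := i
  refine tapeBlock_congr fun j hj hj' => eq_of_dist_cantorPoint_lt hk h ?_ ?_ <;> push_cast <;>
    nlinarith

/-! ### Universality -/

theorem exists_equiv_fin_add_one (B : Type*) [Finite B] [Nontrivial B] :
    ∃ k, 1 ≤ k ∧ Nonempty (B ≃ Fin (k + 1)) := by
  have hcard := Finite.one_lt_card (α := B)
  exact ⟨Nat.card B - 1, by omega,
    ⟨(Finite.equivFin B).trans (finCongr (Nat.sub_add_cancel hcard.le).symm)⟩⟩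

theorem exists_iterate_streamPoint {B : Type*} {k : ℕ} {dg : B → ℕ} {F : Torus4 → Torus4}
    {G : B → B → B → List B × List B}
    (hF : ∀ t ∈ Set.Icc (0 : ℝ) (1 / 8), ∀ c, ∃ t' ∈ Set.Icc (0 : ℝ) (1 / 8),
      F (streamPoint k dg t c) = streamPoint k dg t' (rewriteStep G c))
    (c : Stream' B × Stream' B) (j : ℕ) :
    ∃ t ∈ Set.Icc (0 : ℝ) (1 / 8),
      F^[j] (streamPoint k dg 0 c) = streamPoint k dg t ((rewriteStep G)^[j] c) := by
  induction j with
  | zero => exact ⟨0, by norm_num, rfl⟩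
  | succ j ih =>
    obtain ⟨t, ht, h⟩ := ih
    rw [Function.iterate_succ_apply', Function.iterate_succ_apply', h]
    exact hF t ht _

section Universality

variable {k : ℕ} (φ : Letter ≃ Fin (k + 1))

/-- The number of the symbol that is read off the block number `i` of a configuration. -/
def readBlock (c : TuringMachine.Code) (d : Config) (i : ℤ) : ℕ :=
  readWord φ c ((tapeBlock c.blockLength d.tape i).map φ)

theorem readBlock_withState_halt {c : TuringMachine.Code} {σ : ℤ → ℕ} {i : ℤ}
    (h : σ i < c.numSymbols) : readBlock φ c (c.withState .halt σ) i = σ i := by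
  rw [readBlock, c.tapeBlock_withState, List.map_cons, List.map_map]
  exact readWord_eq φ h (by split_ifs <;> simp)

theorem head_eq_halt_of_readBlock_lt {c : TuringMachine.Code} {d : Config}
    (hd : d.1.head.IsState) (h : readBlock φ c d 0 < c.numSymbols) : d.1.head = .halt := by
  obtain ⟨L, hL⟩ := Nat.exists_eq_succ_of_ne_zero c.blockLength_pos.ne'
  have hfirst : d.tape (((L + 1 : ℕ) : ℤ) * 0 + ((0 : Fin (L + 1)) : ℕ)) = d.1.head := by
    simp [Config.tape]
  rw [readBlock, hL, tapeBlock, List.ofFn_succ, List.map_cons, hfirst] at h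
  rcases head_eq_of_readWord_lt φ h with hdelim | hhalt
  · rw [φ.injective hdelim] at hd
    exact hd.elim
  · exact φ.injective hhalt

theorem TuringMachine.haltsWithOutput_iff {Q A : Type*} {m l : ℕ} (T : TuringMachine Q A)
    (eQ : Q ≃ Fin m) (eA : A ≃ Fin l) (s : ℤ → A) (n : ℕ)
    (t : Set.Icc (-(n : ℤ)) (n : ℤ) → A) :
    T.HaltsWithOutput s n t ↔ ∃ j, ∀ i : Set.Icc (-(n : ℤ)) (n : ℤ), readBlock φ (T.code eQ eA)
      (machineStep^[j] ((T.code eQ eA).withState .start fun i => eA (s i))) i = eA (t i) := by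
  have hread (t' : ℤ → A) (i : ℤ) : readBlock φ (T.code eQ eA)
      ((T.code eQ eA).withState .halt fun i => eA (t' i)) i = eA (t' i) :=
    readBlock_withState_halt φ (eA (t' i)).isLt
  constructor
  · rintro ⟨t', hT, ht⟩
    obtain ⟨j, hj⟩ := hT.reach eQ eA
    exact ⟨j, fun i => by rw [hj, hread, ht]⟩
  · rintro ⟨j, hj⟩
    have hstate :=
      isState_iterate (d := (T.code eQ eA).withState .start fun i => eA (s i)) trivial j
    have hlt := (hj ⟨0, by simp⟩).trans_lt (eA _).isLt
    obtain ⟨t', hT, ht'⟩ := T.exists_haltsWithTape eQ eA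
      (head_eq_halt_of_readBlock_lt φ hstate hlt)
    refine ⟨t', hT, fun i => eA.injective (Fin.ext ?_)⟩
    rw [← hread, ← ht', hj]

theorem streamPoint_eq_cantorPoint (x : ℝ) (d : Config) :
    streamPoint k (fun a => (φ a : ℕ)) x d =
      ((circlePt x, 1), cantorPoint k fun i => φ (d.tape i)) := by
  simp only [cantorPoint_eq, Config.tape_add_one, Config.tape_neg]
  rfl

variable {A : Type*} {l : ℕ} (c : TuringMachine.Code) (eA : A ≃ Fin l)

theorem inputPoint_blockCoding (s : ℤ → A) : (blockCoding φ).inputPoint c eA 0 s =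
    streamPoint k (fun a => (φ a : ℕ)) 0 (c.withState .start fun i => eA (s i)) := by
  have hencode : (blockCoding φ).encode c eA s =
      fun i => φ ((c.withState .start fun i => eA (s i)).tape i) :=
    funext fun j => by rw [c.tape_withState]; rfl
  rw [BlockCoding.inputPoint, hencode, streamPoint_eq_cantorPoint]
  simp [toTorus2, circlePt]

theorem circlePt_mem_ball {x : ℝ} (hx : x ∈ Set.Icc (0 : ℝ) (1 / 8)) :
    ((circlePt x, 1) : Torus2) ∈
      Metric.ball (toTorus2 (((0 : ℚ × ℚ).1 : ℝ), ((0 : ℚ × ℚ).2 : ℝ))) ((1 : ℚ) : ℝ) := by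
  simpa [toTorus2, Prod.dist_eq] using dist_circlePt_one_lt_one hx

theorem streamPoint_mem_outputSet_iff (hk : 1 ≤ k) {x : ℝ} (hx : x ∈ Set.Icc (0 : ℝ) (1 / 8))
    {d : Config} {n : ℕ} {t : Set.Icc (-(n : ℤ)) (n : ℤ) → A} :
    streamPoint k (fun a => (φ a : ℕ)) x d ∈ (blockCoding φ).outputSet c eA 0 1 n t ↔
      ∀ i : Set.Icc (-(n : ℤ)) (n : ℤ), readBlock φ c d i = eA (t i) := by
  rw [streamPoint_eq_cantorPoint]
  constructor
  · rintro ⟨-, hthick : cantorPoint k (fun i => φ (d.tape i)) ∈ Metric.thickening _ _⟩ i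
    obtain ⟨-, ⟨u, hu, rfl⟩, hdist⟩ := Metric.mem_thickening_iff.1 hthick
    rw [← hu i, readBlock, ← map_tapeBlock,
      tapeBlock_eq_of_dist_cantorPoint_lt hk c.blockLength_pos hdist i]
    rfl
  · intro hread
    have hcyl : (fun i => φ (d.tape i)) ∈ (blockCoding φ).cylinder c eA n t := fun i => by
      rw [← hread i, readBlock, ← map_tapeBlock]
      rfl
    have hradius : (0 : ℝ) < ((10 * (k : ℝ)) ^ ((n + 1) * (blockCoding φ).len c))⁻¹ := by
      positivity
    exact Set.mk_mem_prod (circlePt_mem_ball hx)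
      (Metric.self_subset_thickening hradius _ (Set.mem_image_of_mem _ hcyl))

end Universality

theorem proposition1p9 :
    ∃ (Φ : Diffeomorph torus4Model torus4Model Torus4 Torus4 ∞) (k : ℕ) (K : BlockCoding k)
      (x h : ℚ × ℚ) (ρ : ℚ),
      IsComputableTorusMap Φ ∧ 1 ≤ k ∧
      ∀ (Q : Type*) (A : Type*) (m l : ℕ) (eQ : Q ≃ Fin m) (eA : A ≃ Fin l), 2 ≤ l →
      ∀ (T : TuringMachine Q A) (s : ℤ → A) (n : ℕ) (t : Set.Icc (-(n : ℤ)) (n : ℤ) → A),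
        T.HaltsWithOutput s n t ↔
          ∃ j : ℕ, Φ^[j] (K.inputPoint (T.code eQ eA) eA x s) ∈
            K.outputSet (T.code eQ eA) eA h ρ n t := by
  have : Nontrivial Letter := ⟨.one, .start, by simp⟩
  obtain ⟨k, hk, ⟨φ⟩⟩ := exists_equiv_fin_add_one Letter
  obtain ⟨F, ⟨hlift, Φ, rfl⟩, hstep⟩ := exists_diffeo_rewriteStep hk (dg := fun a => (φ a : ℕ))
    (Fin.val_injective.comp φ.injective) (fun a => Fin.is_le _) rule
  refine ⟨Φ, k, blockCoding φ, 0, 0, 1, hlift.isComputableTorusMap, hk,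
    fun Q A m l eQ eA _ T s n t => ?_⟩
  rw [T.haltsWithOutput_iff φ eQ eA, inputPoint_blockCoding]
  refine exists_congr fun j => ?_
  obtain ⟨x, hx, horbit⟩ := exists_iterate_streamPoint hstep _ j
  rw [horbit]
  exact (streamPoint_mem_outputSet_iff φ _ eA hk hx).symm
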